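/- There is an absolute constant $A>0$ such that the following holds. Let $(\mathcal X,\mathcal A)$ be a measurable space, let $X_1,\dots,X_n$ be independent $\mathcal X$-valued random variables with common law $\mu$ ($X$ denotes a variable of law $\mu$), and let $\varepsilon_1,\dots,\varepsilon_n$ be independent Rademacher variables, independent of $(X_1,\dots,X_n)$. Let $\mathcal G$ be a pointwise measurable class of bounded real functions on $\mathcal X$, that is, a class of measurable functions having a countable subclass $\mathcal G_0$ such that each $g\in\mathcal G$ is the pointwise limit of a sequence in $\mathcal G_0$. Let $G$ be a finite-valued measurable function with $|g(x)|\le G(x)$ for all $g\in\mathcal G$, $x\in\mathcal X$, and put $N(\varepsilon,\mathcal G)=\sup_Q N(\varepsilon\sqrt{Q(G^2)},\mathcal G,d_Q)$, the supremum being over all probability measures $Q$ on $(\mathcal X,\mathcal A)$ with $0<Q(G^2)<\infty$, where $d_Q$ is the $L_2(Q)$-distance and $N(r,\mathcal G,d_Q)$ is the minimal number of open $d_Q$-balls of radius $r$, with centres in $L_2(Q)$, needed to cover $\mathcal G$. Suppose that for some constants $C,\nu\ge 1$ and $\beta>0$, (i) $\mathbb E[G(X)^2]\le\beta^2$; (ii)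 $N(\varepsilon,\mathcal G)\le C\varepsilon^{-\nu}$ for $0<\varepsilon<1$. Put $\sigma_0=\big(\sup_{g\in\mathcal G}\mathbb E[g(X)^2]\big)^{1/2}$, $\|\psi\|_{\mathcal G}=\sup_{g\in\mathcal G}|\psi(g)|$, $\|g\|_\infty=\sup_x|g(x)|$, $C_1=C^{1/\nu}\vee e$, $C_2=\frac{1}{4\sqrt{\nu\log C_1}}$ and $C_3=\frac{C_1^2}{16\nu}$. (a) If $0<\sigma\le\beta$, $\sigma_0^2\le\sigma^2$ and $\sup_{g\in\mathcal G}\|g\|_\infty\le\frac{1}{4\sqrt\nu}\sqrt{n\sigma^2/\log(C_1\beta/\sigma)}$, then $$\mathbb E\Big\|\sum_{i=1}^n\varepsilon_i g(X_i)\Big\|_{\mathcal G}\le A\sqrt{\nu n\sigma^2\log(C_1\beta/\sigma)}.$$ (b) If $\sup_{g\in\mathcal G}\|g\|_\infty\le U$, where $\sigma_0\le U\le C_2\sqrt n\,\beta$, then $$\mathbb E\Big\|\sum_{i=1}^n\varepsilon_i g(X_i)\Big\|_{\mathcal G}\le A\Big\{\sqrt{\nu n\sigma_0^2\log(C_1\beta/\sigma_0)}+2\nu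 U\log\big(C_3 n(\beta/U)^2\big)\Big\},$$ where the first term is $0$ if $\sigma_0=0$ and the second is $0$ if $U=0$. -/

import Mathlib

open MeasureTheory ProbabilityTheory Filter Topology
open scoped ENNReal

universe u v

namespace EmpiricalProcess

/-- A pointwise measurable class: measurable real functions, every one of which is the pointwise
limit of a sequence taken from a fixed countable subclass. -/
def IsPointwiseMeasurable {S : Type u} [MeasurableSpace S] (𝒢 : Set (S → ℝ)) : Prop :=
  (∀ g ∈ 𝒢, Measurable g) ∧
    ∃ 𝒢₀ : Set (S → ℝ), 𝒢₀ ⊆ 𝒢 ∧ 𝒢₀.Countable ∧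
      ∀ g ∈ 𝒢, ∃ h : ℕ → S → ℝ,
        (∀ m, h m ∈ 𝒢₀) ∧ ∀ x, Tendsto (fun m => h m x) atTop (𝓝 (g x))

/-- The covering number `N(r, 𝒢, d_Q)`: the least number of open balls of radius `r` for the
`L₂(Q)`-distance that cover `𝒢` (`⊤` if no finite number does). The centres are elements of
`L₂(Q)`; they are not required to lie in `𝒢`. -/
noncomputable def coveringNumber {S : Type u} [MeasurableSpace S]
    (r : ℝ) (𝒢 : Set (S → ℝ)) (Q : Measure S) : ℕ∞ :=
  ⨅ (T : Finset (S → ℝ)) (_ : ∀ h ∈ T, MemLp h 2 Q)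
    (_ : ∀ g ∈ 𝒢, ∃ h ∈ T, eLpNorm (fun x => g x - h x) 2 Q < ENNReal.ofReal r),
    (T.card : ℕ∞)

/-- The uniform covering number `N(ε, 𝒢) = sup_Q N(ε √(Q(G²)), 𝒢, d_Q)`, the supremum being taken
over all probability measures `Q` with `0 < Q(G²) < ∞`. -/
noncomputable def uniformCoveringNumber {S : Type u} [MeasurableSpace S]
    (ε : ℝ) (𝒢 : Set (S → ℝ)) (G : S → ℝ) : ℕ∞ :=
  ⨆ (Q : Measure S) (_ : IsProbabilityMeasure Q) (_ : Integrable (fun x => G x ^ 2) Q)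
    (_ : 0 < ∫ x, G x ^ 2 ∂Q),
    coveringNumber (ε * √(∫ x, G x ^ 2 ∂Q)) 𝒢 Q

/-- `𝒢` is a pointwise measurable class of bounded functions with a finite-valued measurable
envelope `G`, such that `E[G(X)²] ≤ β²` for `X` of law `μ` and `N(ε, 𝒢) ≤ C ε^{-ν}` for
`0 < ε < 1`, where `C, ν ≥ 1` and `β > 0`. -/
structure IsUniformEntropyClass {S : Type u} [MeasurableSpace S] (μ : Measure S)
    (𝒢 : Set (S → ℝ)) (G : S → ℝ) (C ν β : ℝ) : Prop where
  one_le_C : 1 ≤ C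
  one_le_ν : 1 ≤ ν
  β_pos : 0 < β
  pointwiseMeasurable : IsPointwiseMeasurable 𝒢
  bounded : ∀ g ∈ 𝒢, ∃ M : ℝ, ∀ x, |g x| ≤ M
  envelope_measurable : Measurable G
  envelope : ∀ g ∈ 𝒢, ∀ x, |g x| ≤ G x
  envelope_sq_integrable : Integrable (fun x => G x ^ 2) μ
  envelope_sq_le : ∫ x, G x ^ 2 ∂μ ≤ β ^ 2
  entropy : ∀ ε : ℝ, 0 < ε → ε < 1 →
    (uniformCoveringNumber ε 𝒢 G : ℝ≥0∞) ≤ ENNReal.ofReal (C * ε ^ (-ν))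

/-- `X₁, …, Xₙ` are independent with common law `μ`, and `ε₁, …, εₙ` are independent Rademacher
variables, independent of `(X₁, …, Xₙ)`. -/
structure IsSymmetrizedSample {Ω : Type v} [MeasurableSpace Ω] {S : Type u} [MeasurableSpace S]
    (P : Measure Ω) (μ : Measure S) {n : ℕ} (X : Fin n → Ω → S) (ε : Fin n → Ω → ℝ) : Prop where
  measurable_X : ∀ i, Measurable (X i)
  map_X : ∀ i, P.map (X i) = μ
  indep_X : iIndepFun X P
  measurable_ε : ∀ i, Measurable (ε i)
  prob_ε_one : ∀ i, P {ω | ε i ω = 1} = 1 / 2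
  prob_ε_neg_one : ∀ i, P {ω | ε i ω = -1} = 1 / 2
  indep_ε : iIndepFun ε P
  indep_X_ε : IndepFun (fun ω i => X i ω) (fun ω i => ε i ω) P

/-- `σ₀ = (sup_{g ∈ 𝒢} E[g(X)²])^{1/2}` for `X` of law `μ`. -/
noncomputable def sigmaZero {S : Type u} [MeasurableSpace S] (μ : Measure S)
    (𝒢 : Set (S → ℝ)) : ℝ :=
  √(⨆ g : 𝒢, ∫ x, (g : S → ℝ) x ^ 2 ∂μ)

/-- `E ‖∑ᵢ εᵢ g(Xᵢ)‖_𝒢`, the expectation of the supremum over `g ∈ 𝒢` of `|∑ᵢ εᵢ g(Xᵢ)|`, as an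
extended nonnegative number. -/
noncomputable def rademacherMoment {Ω : Type v} [MeasurableSpace Ω] {S : Type u} (P : Measure Ω)
    (𝒢 : Set (S → ℝ)) {n : ℕ} (X : Fin n → Ω → S) (ε : Fin n → Ω → ℝ) : ℝ≥0∞ :=
  ∫⁻ ω, ⨆ g ∈ 𝒢, ENNReal.ofReal |∑ i, ε i ω * g (X i ω)| ∂P

/-- `C₁ = C^{1/ν} ∨ e`. -/
noncomputable def C₁ (C ν : ℝ) : ℝ := max (C ^ (1 / ν)) (Real.exp 1)

/-- `C₂ = 1 / (4 √(ν log C₁))`. -/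
noncomputable def C₂ (C ν : ℝ) : ℝ := 1 / (4 * √(ν * Real.log (C₁ C ν)))

/-- `C₃ = C₁² / (16 ν)`. -/
noncomputable def C₃ (C ν : ℝ) : ℝ := C₁ C ν ^ 2 / (16 * ν)

end EmpiricalProcess

/-! Both bounds come from one estimate, `rademacherMoment_le_of_sigmaZero_le`: at any variance level
`σ` with `sigmaZero ≤ σ ≤ β`, the moment is at most a constant times `√(ν n σ² l) + ν U l`, where `l
= log (C₁ β / σ)`.

Fix the sample. With `V = sup ∑ f(xᵢ)²` and `Y = ∑ G(xᵢ)²`, dyadic chaining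
(`signAvg_iSup_le_of_covering`) bounds the average over signs by a multiple of `√(ν V log (C₁ √Y /
√V))`. The logarithm depends on the random ratio `Y / V`; a tangent line at `β / σ`
(`sq_mul_log_le`) replaces this by `√q`, with `q` affine in `V` and `Y`.

Put `w = E √q`, so that `w² ≤ E q`. The mean of `Y` is at most `n β²`. For `V`, symmetrization
(`integral_iSup_sum_le`) leads to the Rademacher process of the squares `f²`. As `f ↦ f²` is
`2U`-Lipschitz on `[-U, U]`, the same chaining bound controls it by a multiple of `U w`; carrying a
Lipschitz image through the chaining replaces the contraction principle. Hence `w² ≤ a² + b w` with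
`a² = 2 ν n σ² l` and `b = 192 ν U l`, and so `w ≤ a + b`.

In (a) the bound on the functions makes `ν U l` at most a quarter of the first term. In (b) the
level is the larger of `sigmaZero` and `4 √ν U / √n`. -/

namespace EmpiricalProcess

/-! ### Averages over signs and the finite maximal inequality. -/

/-- The sign `±1` encoded by a Boolean. -/
def boolSign (b : Bool) : ℝ := if b then 1 else -1

/-- The signed sum `∑ᵢ sᵢ aᵢ`. -/
def signSum {n : ℕ} (s : Fin n → Bool) (a : Fin n → ℝ) : ℝ := ∑ i, boolSign (s i) * a i

/-- The average of a function over all sign patterns. -/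
noncomputable def signAvg {n : ℕ} (f : (Fin n → Bool) → ℝ) : ℝ := (∑ s, f s) / 2 ^ n

lemma abs_boolSign (b : Bool) : |boolSign b| = 1 := by
  cases b <;> simp [boolSign]

section signAvg

variable {n : ℕ}

lemma signAvg_mono {f g : (Fin n → Bool) → ℝ} (h : ∀ s, f s ≤ g s) : signAvg f ≤ signAvg g := by
  unfold signAvg
  gcongr with s
  exact h s

lemma signAvg_add (f g : (Fin n → Bool) → ℝ) :
    signAvg (fun s => f s + g s) = signAvg f + signAvg g := by
  simp [signAvg, Finset.sum_add_distrib, add_div]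

lemma signAvg_const (c : ℝ) : signAvg (fun _ : Fin n → Bool => c) = c := by
  simp [signAvg]

lemma signAvg_const_mul (c : ℝ) (f : (Fin n → Bool) → ℝ) :
    signAvg (fun s => c * f s) = c * signAvg f := by
  simp [signAvg, ← Finset.mul_sum, mul_div_assoc]

lemma signAvg_sum {ι : Type*} (F : Finset ι) (f : ι → (Fin n → Bool) → ℝ) :
    signAvg (fun s => ∑ j ∈ F, f j s) = ∑ j ∈ F, signAvg (f j) := by
  simp only [signAvg]
  rw [Finset.sum_comm, Finset.sum_div]

lemma signAvg_nonneg {f : (Fin n → Bool) → ℝ} (h : ∀ s, 0 ≤ f s) : 0 ≤ signAvg f :=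
  div_nonneg (Finset.sum_nonneg fun s _ => h s) (by positivity)

lemma signSum_sub (s : Fin n → Bool) (a b : Fin n → ℝ) :
    signSum s (fun i => a i - b i) = signSum s a - signSum s b := by
  simp [signSum, mul_sub, Finset.sum_sub_distrib]

/-- Cauchy–Schwarz. The factor `√n` is harmless: the bound serves for the chaining remainder, where
`r → 0` with `n` fixed. -/
lemma abs_signSum_le_sqrt (s : Fin n → Bool) (a : Fin n → ℝ) {r : ℝ} (hr : 0 ≤ r)
    (h : ∑ i, a i ^ 2 ≤ r ^ 2) : |signSum s a| ≤ √n * r := by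
  refine abs_le_of_sq_le_sq ?_ (by positivity)
  rw [mul_pow, Real.sq_sqrt (Nat.cast_nonneg n)]
  calc signSum s a ^ 2 ≤ (∑ i, boolSign (s i) ^ 2) * ∑ i, a i ^ 2 :=
        Finset.sum_mul_sq_le_sq_mul_sq _ _ _
    _ = n * ∑ i, a i ^ 2 := by
        congr 1
        simp [← sq_abs (boolSign _), abs_boolSign]
    _ ≤ n * r ^ 2 := by gcongr

/-- Sub-Gaussianity: the average factors into `∏ cosh (l aᵢ)`, and `cosh t ≤ exp (t² / 2)`. -/
lemma signAvg_exp_le (a : Fin n → ℝ) (l : ℝ) :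
    signAvg (fun s => Real.exp (l * signSum s a)) ≤ Real.exp (l ^ 2 * (∑ i, a i ^ 2) / 2) := by
  have h1 : ∑ s : Fin n → Bool, Real.exp (l * signSum s a)
      = ∏ i, (2 * Real.cosh (l * a i)) := by
    have h2 : ∀ i, 2 * Real.cosh (l * a i) = ∑ b : Bool, Real.exp (l * (boolSign b * a i)) := by
      intro i
      rw [Real.cosh_eq]
      simp [boolSign]
      ring
    simp_rw [h2]
    rw [Finset.prod_univ_sum, Fintype.piFinset_univ]
    refine Finset.sum_congr rfl fun s _ => ?_
    rw [← Real.exp_sum, signSum, Finset.mul_sum]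
  rw [signAvg, h1, Finset.prod_mul_distrib]
  simp only [Finset.prod_const, Finset.card_univ, Fintype.card_fin]
  rw [mul_div_cancel_left₀ _ (by positivity), Finset.mul_sum, Finset.sum_div, Real.exp_sum]
  refine Finset.prod_le_prod (fun i _ => (Real.cosh_pos _).le) fun i _ => ?_
  rw [← mul_pow]
  exact Real.cosh_le_exp_half_sq _

/-- The maximal inequality for finitely many Rademacher sums. -/
lemma exists_dominating_signAvg_le {ι : Type*} (F : Finset ι) (a : ι → Fin n → ℝ) {τ N : ℝ}
    (hτ : 0 ≤ τ) (ha : ∀ j ∈ F, ∑ i, a j i ^ 2 ≤ τ ^ 2) (hN : 1 ≤ N) (hF : (F.card : ℝ) ≤ N) :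
    ∃ M : (Fin n → Bool) → ℝ, (∀ s, ∀ j ∈ F, |signSum s (a j)| ≤ M s) ∧
      signAvg M ≤ τ * √(2 * Real.log (2 * N)) := by
  rcases hτ.eq_or_lt with rfl | hτ
  · refine ⟨fun _ => 0, fun s j hj => ?_, by simp [signAvg_const]⟩
    simpa using abs_signSum_le_sqrt s (a j) le_rfl (ha j hj)
  have hlog : 0 < Real.log (2 * N) := Real.log_pos (by linarith)
  set q := √(2 * Real.log (2 * N)) with hq
  have hq0 : 0 < q := Real.sqrt_pos.2 (by positivity)
  have hq2 : q ^ 2 = 2 * Real.log (2 * N) := Real.sq_sqrt (by positivity)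
  -- This `l` makes `l² τ² / 2 = q² / 2 = log (2N)`, so the two terms of `log c` are equal.
  set l := q / τ with hl
  have hl0 : 0 < l := by positivity
  set c := 2 * N * Real.exp (l ^ 2 * τ ^ 2 / 2) with hc
  have hc0 : 0 < c := by positivity
  have hlogc : Real.log c = q ^ 2 := by
    rw [hc, Real.log_mul (by positivity) (by positivity), Real.log_exp]
    have : l ^ 2 * τ ^ 2 = q ^ 2 := by rw [hl]; field_simp
    rw [this]
    linarith
  set E : (Fin n → Bool) → ℝ := fun s =>
    ∑ j ∈ F, (Real.exp (l * signSum s (a j)) + Real.exp (-l * signSum s (a j))) with hE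
  have hEavg : signAvg E ≤ c := by
    rw [hE, signAvg_sum]
    calc ∑ j ∈ F, signAvg (fun s => Real.exp (l * signSum s (a j))
            + Real.exp (-l * signSum s (a j)))
        ≤ ∑ j ∈ F, 2 * Real.exp (l ^ 2 * τ ^ 2 / 2) := by
          refine Finset.sum_le_sum fun j hj => ?_
          rw [signAvg_add, two_mul]
          have h0 : Real.exp (l ^ 2 * (∑ i, a j i ^ 2) / 2) ≤ Real.exp (l ^ 2 * τ ^ 2 / 2) := by
            have := ha j hj
            gcongr
          refine add_le_add ((signAvg_exp_le _ _).trans h0) ((signAvg_exp_le _ _).trans ?_)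
          rwa [neg_sq]
      _ = F.card * (2 * Real.exp (l ^ 2 * τ ^ 2 / 2)) := by simp
      _ ≤ N * (2 * Real.exp (l ^ 2 * τ ^ 2 / 2)) := by gcongr
      _ = c := by rw [hc]; ring
  -- The tangent to `log` at `c` stands in for Jensen's inequality: `log E ≤ E / c + log c - 1`,
  -- whose average is at most `log c = q²`.
  refine ⟨fun s => l⁻¹ * (c⁻¹ * E s + (Real.log c - 1)), fun s j hj => ?_, ?_⟩
  · beta_reduce
    rw [inv_mul_eq_div, le_div_iff₀ hl0]
    have h1 : Real.exp (|signSum s (a j)| * l) ≤ E s := by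
      have h2 : Real.exp (|signSum s (a j)| * l)
          ≤ Real.exp (l * signSum s (a j)) + Real.exp (-l * signSum s (a j)) := by
        rcases abs_cases (signSum s (a j)) with ⟨h, _⟩ | ⟨h, _⟩ <;> rw [h]
        · rw [mul_comm]
          exact le_add_of_nonneg_right (Real.exp_pos _).le
        · rw [show -signSum s (a j) * l = -l * signSum s (a j) by ring]
          exact le_add_of_nonneg_left (Real.exp_pos _).le
      exact h2.trans (Finset.single_le_sum
        (f := fun j => Real.exp (l * signSum s (a j)) + Real.exp (-l * signSum s (a j)))
        (fun j _ => by positivity) hj)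
    have hE0 : 0 < E s := (Real.exp_pos _).trans_le h1
    have h3 : |signSum s (a j)| * l ≤ Real.log (E s) := (Real.le_log_iff_exp_le hE0).2 h1
    have h4 := Real.log_le_sub_one_of_pos (show 0 < c⁻¹ * E s by positivity)
    rw [Real.log_mul (by positivity) hE0.ne', Real.log_inv] at h4
    linarith
  · rw [signAvg_const_mul, signAvg_add, signAvg_const_mul, signAvg_const]
    have h5 : c⁻¹ * signAvg E ≤ 1 := by
      rw [inv_mul_le_iff₀ hc0]
      linarith
    calc l⁻¹ * (c⁻¹ * signAvg E + (Real.log c - 1)) ≤ l⁻¹ * q ^ 2 := by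
          gcongr
          linarith
      _ = τ * q := by rw [hl]; field_simp

/-! ### Dyadic chaining. -/

lemma sum_range_add_three_div_two_pow (J : ℕ) :
    ∑ j ∈ Finset.range J, ((j : ℝ) + 3) / 2 ^ j = 8 - (2 * J + 8) / 2 ^ J := by
  induction J with
  | zero => norm_num
  | succ J ih =>
    rw [Finset.sum_range_succ, ih]
    push_cast
    field_simp
    ring

lemma sum_add_sq_le (a b : Fin n → ℝ) {p q : ℝ} (hp : 0 ≤ p) (hq : 0 ≤ q)
    (ha : ∑ i, a i ^ 2 ≤ p ^ 2) (hb : ∑ i, b i ^ 2 ≤ q ^ 2) :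
    ∑ i, (a i + b i) ^ 2 ≤ (p + q) ^ 2 := by
  have h : ∑ i, a i * b i ≤ p * q := by
    refine le_of_sq_le_sq ?_ (by positivity)
    rw [mul_pow]
    refine (Finset.sum_mul_sq_le_sq_mul_sq _ _ _).trans ?_
    gcongr
  have : ∑ i, (a i + b i) ^ 2 = ∑ i, a i ^ 2 + 2 * ∑ i, a i * b i + ∑ i, b i ^ 2 := by
    rw [Finset.mul_sum, ← Finset.sum_add_distrib, ← Finset.sum_add_distrib]
    exact Finset.sum_congr rfl fun i _ => by ring
  nlinarith

lemma sum_sq_le_of_abs_le {a b : Fin n → ℝ} {L p : ℝ} (hab : ∀ i, |a i| ≤ L * |b i|)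
    (hb : ∑ i, b i ^ 2 ≤ p ^ 2) : ∑ i, a i ^ 2 ≤ (L * p) ^ 2 := by
  calc ∑ i, a i ^ 2 ≤ ∑ i, L ^ 2 * b i ^ 2 := by
        refine Finset.sum_le_sum fun i _ => ?_
        rw [← sq_abs (a i), ← sq_abs (b i), ← mul_pow]
        exact pow_le_pow_left₀ (abs_nonneg _) (hab i) 2
    _ = L ^ 2 * ∑ i, b i ^ 2 := by rw [Finset.mul_sum]
    _ ≤ L ^ 2 * p ^ 2 := by gcongr
    _ = (L * p) ^ 2 := by ring

/-- Each halving of the radius adds `ν log 2` to the log covering number, and `c ≥ e` lets `log (c R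
/ D)` absorb each `log 2`. The square counts pairs of consecutive centres. -/
lemma two_mul_log_entropy_le {C c ν D R : ℝ} (hC : 1 ≤ C) (hν : 1 ≤ ν) (hc : Real.exp 1 ≤ c)
    (hCc : C ≤ c ^ ν) (hD : 0 < D) (hDR : D ≤ R) (j : ℕ) :
    2 * Real.log (2 * (C * (2 * R / (D / 2 ^ j)) ^ ν) ^ 2)
      ≤ 4 * (ν * Real.log (c * R / D)) * (j + 3) := by
  have hR : 0 < R := hD.trans_le hDR
  have hc0 : 0 < c := (Real.exp_pos 1).trans_le hc
  have hC0 : 0 < C := by linarith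
  have hlc : 1 ≤ Real.log c := (Real.le_log_iff_exp_le hc0).2 hc
  have hlC : Real.log C ≤ ν * Real.log c := by
    rw [← Real.log_rpow hc0]
    exact Real.log_le_log hC0 hCc
  have hlD : Real.log D ≤ Real.log R := Real.log_le_log hD hDR
  have hl2 : Real.log 2 ≤ 1 := by linarith [Real.log_two_lt_d9]
  have hl20 : 0 ≤ Real.log 2 := Real.log_nonneg (by norm_num)
  have e1 : Real.log (c * R / D) = Real.log c + Real.log R - Real.log D := by
    rw [Real.log_div (by positivity) hD.ne', Real.log_mul hc0.ne' hR.ne']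
  have e2 : Real.log (2 * (C * (2 * R / (D / 2 ^ j)) ^ ν) ^ 2)
      = Real.log 2 + 2 * (Real.log C
        + ν * (Real.log 2 + Real.log R - (Real.log D - j * Real.log 2))) := by
    rw [Real.log_mul (by norm_num) (by positivity), Real.log_pow,
      Real.log_mul (by positivity) (by positivity), Real.log_rpow (by positivity),
      Real.log_div (by positivity) (by positivity), Real.log_mul (by positivity) (by positivity),
      Real.log_div (by positivity) (by positivity), Real.log_pow]
    norm_num
  rw [e2, e1]
  set d := Real.log R - Real.log D with hd
  have hd0 : 0 ≤ d := by linarith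
  have hj : (0 : ℝ) ≤ j := Nat.cast_nonneg j
  have h1 : (j + 2) * Real.log 2 ≤ (j + 2) * (Real.log c + d) := by
    gcongr
    linarith
  have h2 : Real.log 2 ≤ 2 * ν * Real.log 2 := by nlinarith
  have h3 : ν * ((j + 2) * Real.log 2) ≤ ν * ((j + 2) * (Real.log c + d)) := by gcongr
  nlinarith

/-- Dudley's entropy bound for a Rademacher process whose index set has polynomial covering
numbers, by dyadic chaining. The process is driven by the Lipschitz image `w` of `v`. -/
theorem signAvg_iSup_le_of_covering {ι : Type*} [Nonempty ι] (v w : ι → Fin n → ℝ)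
    {C c ν D R L : ℝ} (hC : 1 ≤ C) (hν : 1 ≤ ν) (hc : Real.exp 1 ≤ c) (hCc : C ≤ c ^ ν)
    (hD : 0 < D) (hDR : D ≤ R) (hL : 0 ≤ L)
    (hw : ∀ k i, |w k i| ≤ L * |v k i|)
    (hwv : ∀ k j i, |w k i - w j i| ≤ L * |v k i - v j i|)
    (hv : ∀ k, ∑ i, v k i ^ 2 ≤ D ^ 2)
    (hcov : ∀ r, 0 < r → r ≤ R → ∃ F : Finset ι, (F.card : ℝ) ≤ C * (2 * R / r) ^ ν ∧
      ∀ k, ∃ j ∈ F, ∑ i, (v k i - v j i) ^ 2 ≤ r ^ 2) :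
    signAvg (fun s => ⨆ k, |signSum s (w k)|) ≤ 48 * L * √(ν * (D ^ 2 * Real.log (c * R / D))) := by
  classical
  have hR : 0 < R := hD.trans_le hDR
  set r : ℕ → ℝ := fun j => D / 2 ^ j with hr
  have hr0 : ∀ j, 0 < r j := fun j => by positivity
  have hrD : ∀ j, r j ≤ D := fun j => div_le_self hD.le (one_le_pow₀ (by norm_num))
  have hrs : ∀ j, r j = 2 * r (j + 1) := fun j => by simp only [hr]; field_simp; ring
  set N : ℕ → ℝ := fun j => C * (2 * R / r j) ^ ν with hN
  have hN1 : ∀ j, 1 ≤ N j := by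
    intro j
    refine one_le_mul_of_one_le_of_one_le hC (Real.one_le_rpow ?_ (by linarith))
    rw [le_div_iff₀ (hr0 j)]
    linarith [hrD j]
  have hNm : ∀ j, N j ≤ N (j + 1) := by
    intro j
    have h1 : r (j + 1) ≤ r j := by rw [hrs j]; linarith [hr0 (j + 1)]
    have h2 := hr0 (j + 1)
    have h3 := hr0 j
    simp only [hN]
    gcongr
  choose F hF π hπF hπ using fun j => hcov (r j) (hr0 j) ((hrD j).trans hDR)
  -- The cost of level `j`: links have length at most `r j + r (j - 1) = 3 r j`, and there are at
  -- most `N j ^ 2` of them. Level `0` has no link and is bounded wastefully to fit the same form.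
  set b : ℕ → ℝ := fun j => 3 * L * r j * √(2 * Real.log (2 * N j ^ 2)) with hb
  obtain ⟨M₀, hM₀, hM₀'⟩ := exists_dominating_signAvg_le (F 0) w (τ := 3 * L * r 0)
    (N := N 0 ^ 2) (by have := hr0 0; positivity)
    (fun j _ => (sum_sq_le_of_abs_le (hw j) (hv j)).trans (by
      have h1 : r 0 = D := by simp [hr]
      rw [h1]
      gcongr
      nlinarith)) (one_le_pow₀ (hN1 0)) ((hF 0).trans (le_self_pow₀ (hN1 0) two_ne_zero))
  have hstep : ∀ j, ∃ M : (Fin n → Bool) → ℝ,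
      (∀ s k, |signSum s (fun i => w (π (j + 1) k) i - w (π j k) i)| ≤ M s) ∧
        signAvg M ≤ b (j + 1) := by
    intro j
    obtain ⟨M, hM, hM'⟩ := exists_dominating_signAvg_le
      -- Only pairs of close centres are kept; by the triangle inequality through `k`, every pair
      -- `(π (j + 1) k, π j k)` is among them.
      ((F (j + 1) ×ˢ F j).filter fun p => ∑ i, (v p.1 i - v p.2 i) ^ 2 ≤ (3 * r (j + 1)) ^ 2)
      (fun p i => w p.1 i - w p.2 i) (τ := 3 * L * r (j + 1)) (N := N (j + 1) ^ 2)
      (by have := hr0 (j + 1); positivity)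
      (fun p hp => by
        have := sum_sq_le_of_abs_le (hwv p.1 p.2) (Finset.mem_filter.1 hp).2
        rwa [show L * (3 * r (j + 1)) = 3 * L * r (j + 1) by ring] at this)
      (one_le_pow₀ (hN1 _)) (by
        calc ((((F (j + 1) ×ˢ F j).filter fun p =>
              ∑ i, (v p.1 i - v p.2 i) ^ 2 ≤ (3 * r (j + 1)) ^ 2).card : ℕ) : ℝ)
            ≤ ((F (j + 1) ×ˢ F j).card : ℕ) := by exact_mod_cast Finset.card_filter_le _ _
          _ = (F (j + 1)).card * (F j).card := by rw [Finset.card_product]; push_cast; rfl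
          _ ≤ N (j + 1) * N (j + 1) :=
              mul_le_mul (hF (j + 1)) ((hF j).trans (hNm j)) (Nat.cast_nonneg _)
                (zero_le_one.trans (hN1 (j + 1)))
          _ = N (j + 1) ^ 2 := by ring)
    refine ⟨M, fun s k => hM s (π (j + 1) k, π j k) ?_, hM'⟩
    refine Finset.mem_filter.2 ⟨Finset.mk_mem_product (hπF _ _) (hπF _ _), ?_⟩
    have h1 : ∑ i, (v (π (j + 1) k) i - v k i) ^ 2 ≤ r (j + 1) ^ 2 := by
      simpa only [← neg_sub (v k _), neg_sq] using hπ (j + 1) k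
    have h2 := sum_add_sq_le _ _ (hr0 (j + 1)).le (hr0 j).le h1 (hπ j k)
    simp only [sub_add_sub_cancel] at h2
    rw [hrs j] at h2
    convert h2 using 2
    ring
  choose M hM hM' using hstep
  have hbsum : ∀ J, ∑ j ∈ Finset.range J, b j
      ≤ 48 * L * √(ν * (D ^ 2 * Real.log (c * R / D))) := by
    intro J
    have hlog : 0 ≤ Real.log (c * R / D) := by
      refine Real.log_nonneg ((one_le_div hD).2 ?_)
      have : 1 ≤ c := le_trans (by simp) hc
      nlinarith
    have hbj : ∀ j, b j ≤ 6 * L * √(ν * (D ^ 2 * Real.log (c * R / D))) * ((j + 3) / 2 ^ j) := by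
      intro j
      -- Here `√(j + 3)` is relaxed to `j + 3`, so that the series sums in closed form to at most
      -- `8`; then `6 * 8 = 48`.
      have h1 : √(2 * Real.log (2 * N j ^ 2)) ≤ 2 * √(ν * Real.log (c * R / D)) * (j + 3) := by
        rw [Real.sqrt_le_left (by positivity)]
        refine (two_mul_log_entropy_le hC hν hc hCc hD hDR j).trans ?_
        rw [mul_pow, mul_pow, Real.sq_sqrt (by positivity)]
        norm_num
        gcongr
        nlinarith [(Nat.cast_nonneg j : (0 : ℝ) ≤ j)]
      have h2 : √(ν * (D ^ 2 * Real.log (c * R / D))) = D * √(ν * Real.log (c * R / D)) := by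
        rw [mul_left_comm, Real.sqrt_mul (by positivity), Real.sqrt_sq hD.le]
      rw [h2]
      calc b j ≤ 3 * L * r j * (2 * √(ν * Real.log (c * R / D)) * (j + 3)) := by
            have := hr0 j
            simp only [hb]
            gcongr
        _ = _ := by simp only [hr]; ring
    calc ∑ j ∈ Finset.range J, b j
        ≤ ∑ j ∈ Finset.range J,
            6 * L * √(ν * (D ^ 2 * Real.log (c * R / D))) * (((j : ℝ) + 3) / 2 ^ j) :=
          Finset.sum_le_sum fun j _ => hbj j
      _ ≤ 6 * L * √(ν * (D ^ 2 * Real.log (c * R / D))) * 8 := by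
          rw [← Finset.mul_sum, sum_range_add_three_div_two_pow]
          gcongr
          have : (0 : ℝ) ≤ (2 * J + 8) / 2 ^ J := by positivity
          linarith
      _ = _ := by ring
  have hpath : ∀ s k J, |signSum s (w (π J k))| ≤ M₀ s + ∑ j ∈ Finset.range J, M j s := by
    intro s k J
    induction J with
    | zero => simpa using hM₀ s _ (hπF 0 k)
    | succ J ih =>
      have h1 := hM J s k
      rw [signSum_sub] at h1
      rw [Finset.sum_range_succ]
      have h2 := abs_sub_abs_le_abs_sub (signSum s (w (π (J + 1) k))) (signSum s (w (π J k)))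
      linarith
  -- Stopping at level `J` leaves a remainder that vanishes as `J → ∞`, so no separate continuity of
  -- the process is needed.
  have hJ : ∀ J, signAvg (fun s => ⨆ k, |signSum s (w k)|)
      ≤ 48 * L * √(ν * (D ^ 2 * Real.log (c * R / D))) + √n * (L * r J) := by
    intro J
    calc signAvg (fun s => ⨆ k, |signSum s (w k)|)
        ≤ signAvg (fun s => (M₀ s + ∑ j ∈ Finset.range J, M j s) + √n * (L * r J)) := by
          refine signAvg_mono fun s => ciSup_le fun k => ?_
          have h1 := abs_signSum_le_sqrt s (fun i => w k i - w (π J k) i)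
            (mul_nonneg hL (hr0 J).le) (sum_sq_le_of_abs_le (hwv _ _) (hπ J k))
          rw [signSum_sub] at h1
          have h2 := abs_sub_abs_le_abs_sub (signSum s (w k)) (signSum s (w (π J k)))
          linarith [hpath s k J]
      _ = signAvg M₀ + ∑ j ∈ Finset.range J, signAvg (M j) + √n * (L * r J) := by
          rw [signAvg_add, signAvg_const, signAvg_add, signAvg_sum]
      _ ≤ b 0 + ∑ j ∈ Finset.range J, b (j + 1) + √n * (L * r J) := by
          gcongr with j
          exact hM' j
      _ ≤ _ := by
          rw [add_comm (b 0), ← Finset.sum_range_succ' b]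
          gcongr
          exact hbsum _
  have hrt : Tendsto r atTop (𝓝 0) := by
    simpa [hr, div_eq_mul_inv] using
      (tendsto_pow_atTop_nhds_zero_of_lt_one (r := (2 : ℝ)⁻¹) (by norm_num)
        (by norm_num)).const_mul D
  have hlim := ((hrt.const_mul L).const_mul √n).const_add
    (48 * L * √(ν * (D ^ 2 * Real.log (c * R / D))))
  rw [mul_zero, mul_zero, add_zero] at hlim
  exact ge_of_tendsto' hlim hJ

end signAvg

/-! ### Suprema of uniformly bounded families. -/

lemma bddAbove_range_of_abs_le {ι : Type*} {u : ι → ℝ} {B : ℝ} (h : ∀ k, |u k| ≤ B) :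
    BddAbove (Set.range u) :=
  ⟨B, by rintro _ ⟨k, rfl⟩; exact (abs_le.1 (h k)).2⟩

lemma abs_iSup_le_of_abs_le {ι : Type*} [Nonempty ι] {u : ι → ℝ} {B : ℝ} (h : ∀ k, |u k| ≤ B) :
    |⨆ k, u k| ≤ B := by
  obtain ⟨k⟩ := ‹Nonempty ι›
  have : Nonempty ι := ⟨k⟩
  exact abs_le.2 ⟨(abs_le.1 (h k)).1.trans (le_ciSup (bddAbove_range_of_abs_le h) k),
    ciSup_le fun k => (abs_le.1 (h k)).2⟩

lemma integrable_iSup_of_abs_le {α ι : Type*} [MeasurableSpace α] (m : Measure α)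
    [IsFiniteMeasure m] [Countable ι] [Nonempty ι] {u : ι → α → ℝ} {B : ℝ}
    (hu : ∀ k, Measurable (u k)) (h : ∀ k x, |u k x| ≤ B) :
    Integrable (fun x => ⨆ k, u k x) m :=
  Integrable.of_bound (Measurable.iSup hu).aestronglyMeasurable B
    (ae_of_all _ fun x => abs_iSup_le_of_abs_le fun k => h k x)

lemma abs_sum_le_of_abs_le {n : ℕ} {a : Fin n → ℝ} {B : ℝ} (h : ∀ i, |a i| ≤ B) :
    |∑ i, a i| ≤ n * B := by
  refine (Finset.abs_sum_le_sum_abs _ _).trans ((Finset.sum_le_sum fun i _ => h i).trans ?_)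
  simp

lemma abs_signSum_le_of_abs_le {n : ℕ} {a : Fin n → ℝ} {B : ℝ} (s : Fin n → Bool)
    (h : ∀ i, |a i| ≤ B) : |signSum s a| ≤ n * B := by
  refine abs_sum_le_of_abs_le fun i => ?_
  rw [abs_mul, abs_boolSign, one_mul]
  exact h i

/-! ### Symmetrization with an independent copy. -/

section Symmetrization

variable {S : Type u} [MeasurableSpace S] {μ : Measure S} [IsProbabilityMeasure μ] {n : ℕ}

lemma measurable_signSum_comp {f : S → ℝ} (hf : Measurable f) (s : Fin n → Bool) :
    Measurable fun x : Fin n → S => signSum s fun i => f (x i) := by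
  unfold signSum
  fun_prop

lemma integrable_iSup_abs_signSum {ι : Type*} [Countable ι] [Nonempty ι] {f : ι → S → ℝ} {B : ℝ}
    (hf : ∀ k, Measurable (f k)) (hB : ∀ k x, |f k x| ≤ B) (s : Fin n → Bool) :
    Integrable (fun x : Fin n → S => ⨆ k, |signSum s fun i => f k (x i)|)
      (Measure.pi fun _ => μ) :=
  integrable_iSup_of_abs_le _ (fun k => measurable_abs.comp (measurable_signSum_comp (hf k) s))
    (B := n * B) fun k x => by
      rw [abs_abs]
      exact abs_signSum_le_of_abs_le s fun i => hB k (x i)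

lemma integrable_signAvg {α : Type*} [MeasurableSpace α] {m : Measure α}
    {F : (Fin n → Bool) → α → ℝ} (hF : ∀ s, Integrable (F s) m) :
    Integrable (fun x => signAvg fun s => F s x) m :=
  (integrable_finsetSum _ fun s _ => hF s).div_const _

lemma integral_signAvg {α : Type*} [MeasurableSpace α] {m : Measure α}
    {F : (Fin n → Bool) → α → ℝ} (hF : ∀ s, Integrable (F s) m) :
    ∫ x, signAvg (fun s => F s x) ∂m = signAvg fun s => ∫ x, F s x ∂m := by
  simp only [signAvg]
  rw [integral_div, integral_finsetSum _ fun s _ => hF s]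

lemma measurePreserving_swap_signs (s : Fin n → Bool) :
    MeasurePreserving (fun (a : Fin n → S × S) i => if s i then a i else (a i).swap)
      (Measure.pi fun _ => μ.prod μ) (Measure.pi fun _ => μ.prod μ) := by
  have := measurePreserving_pi (fun _ : Fin n => μ.prod μ) (fun _ => μ.prod μ)
    (f := fun i p => if s i then p else p.swap) fun i => by
      cases s i
      · simpa using Measure.measurePreserving_swap
      · exact MeasurePreserving.id (μ.prod μ)
  exact this

/-- Symmetrization: the signed sums of an independent copy dominate the difference of a sample
and its copy. -/
lemma integral_iSup_abs_sum_sub_le {f : ℕ → S → ℝ} {B : ℝ} (hf : ∀ k, Measurable (f k))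
    (hB : ∀ k x, |f k x| ≤ B) :
    ∫ a : Fin n → S × S, ⨆ k, |∑ i, (f k (a i).1 - f k (a i).2)| ∂(Measure.pi fun _ => μ.prod μ)
      ≤ 2 * ∫ x : Fin n → S, signAvg (fun s => ⨆ k, |signSum s fun i => f k (x i)|)
          ∂(Measure.pi fun _ => μ) := by
  set I := ∫ a : Fin n → S × S, ⨆ k, |∑ i, (f k (a i).1 - f k (a i).2)|
    ∂(Measure.pi fun _ => μ.prod μ) with hI
  have hint := integrable_iSup_abs_signSum (μ := μ) (n := n) hf hB
  have hfst : MeasurePreserving (fun (a : Fin n → S × S) i => (a i).1)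
      (Measure.pi fun _ => μ.prod μ) (Measure.pi fun _ => μ) :=
    measurePreserving_pi _ _ fun _ => measurePreserving_fst
  have hsnd : MeasurePreserving (fun (a : Fin n → S × S) i => (a i).2)
      (Measure.pi fun _ => μ.prod μ) (Measure.pi fun _ => μ) :=
    measurePreserving_pi _ _ fun _ => measurePreserving_snd
  -- For a fixed `s`, exchanging the two copies where the sign is `-1` preserves the product law and
  -- inserts the signs; the triangle inequality then separates the copies.
  have key : ∀ s : Fin n → Bool,
      I ≤ 2 * ∫ x : Fin n → S, ⨆ k, |signSum s fun i => f k (x i)| ∂(Measure.pi fun _ => μ) := by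
    intro s
    have hsw := measurePreserving_swap_signs (μ := μ) s
    have hmeas : Measurable fun a : Fin n → S × S => ⨆ k, |∑ i, (f k (a i).1 - f k (a i).2)| := by
      have := hf
      refine Measurable.iSup fun k => ?_
      have := this k
      fun_prop
    have h1 : I = ∫ a : Fin n → S × S, ⨆ k, |signSum s fun i => f k (a i).1 - f k (a i).2|
        ∂(Measure.pi fun _ => μ.prod μ) := by
      rw [hI]
      conv_lhs => rw [← hsw.map_eq]
      rw [integral_map hsw.measurable.aemeasurable hmeas.aestronglyMeasurable]
      refine integral_congr_ae (ae_of_all _ fun a => ?_)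
      refine iSup_congr fun k => congrArg _ (Finset.sum_congr rfl fun i _ => ?_)
      cases h : s i <;> simp [boolSign, h]
    have i1 : Integrable (fun a : Fin n → S × S => ⨆ k, |signSum s fun i => f k (a i).1|)
        (Measure.pi fun _ => μ.prod μ) := hfst.integrable_comp_of_integrable (hint s)
    have i2 : Integrable (fun a : Fin n → S × S => ⨆ k, |signSum s fun i => f k (a i).2|)
        (Measure.pi fun _ => μ.prod μ) := hsnd.integrable_comp_of_integrable (hint s)
    have e1 : ∫ a : Fin n → S × S, ⨆ k, |signSum s fun i => f k (a i).1|
        ∂(Measure.pi fun _ => μ.prod μ)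
        = ∫ x : Fin n → S, ⨆ k, |signSum s fun i => f k (x i)| ∂(Measure.pi fun _ => μ) := by
      conv_rhs => rw [← hfst.map_eq]
      rw [integral_map hfst.measurable.aemeasurable]
      rw [hfst.map_eq]
      exact (hint s).aestronglyMeasurable
    have e2 : ∫ a : Fin n → S × S, ⨆ k, |signSum s fun i => f k (a i).2|
        ∂(Measure.pi fun _ => μ.prod μ)
        = ∫ x : Fin n → S, ⨆ k, |signSum s fun i => f k (x i)| ∂(Measure.pi fun _ => μ) := by
      conv_rhs => rw [← hsnd.map_eq]
      rw [integral_map hsnd.measurable.aemeasurable]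
      rw [hsnd.map_eq]
      exact (hint s).aestronglyMeasurable
    rw [h1, two_mul]
    nth_rw 1 [← e1]
    rw [← e2, ← integral_add i1 i2]
    refine integral_mono_of_nonneg (ae_of_all _ fun a => Real.iSup_nonneg fun k => abs_nonneg _)
      (i1.add i2) (ae_of_all _ fun a => ciSup_le fun k => ?_)
    have b1 := le_ciSup (bddAbove_range_of_abs_le (u := fun k => |signSum s fun i => f k (a i).1|)
      (B := n * B) fun k => by
        rw [abs_abs]; exact abs_signSum_le_of_abs_le s fun i => hB k _) k
    have b2 := le_ciSup (bddAbove_range_of_abs_le (u := fun k => |signSum s fun i => f k (a i).2|)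
      (B := n * B) fun k => by
        rw [abs_abs]; exact abs_signSum_le_of_abs_le s fun i => hB k _) k
    rw [signSum_sub]
    exact (abs_sub _ _).trans (add_le_add b1 b2)
  rw [integral_signAvg hint, ← signAvg_const_mul]
  calc I = signAvg (fun _ : Fin n → Bool => I) := (signAvg_const I).symm
    _ ≤ _ := signAvg_mono key

/-- Each mean `n ∫ f k` is the integral over an independent copy, and the supremum of integrals is
at most the integral of the supremum; the centred part is then symmetrized. -/
lemma integral_iSup_sum_le {f : ℕ → S → ℝ} {B v : ℝ} (hf : ∀ k, Measurable (f k))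
    (hB : ∀ k x, |f k x| ≤ B) (hv : ∀ k, ∫ x, f k x ∂μ ≤ v) :
    ∫ x : Fin n → S, ⨆ k, ∑ i, f k (x i) ∂(Measure.pi fun _ => μ)
      ≤ n * v + 2 * ∫ x : Fin n → S, signAvg (fun s => ⨆ k, |signSum s fun i => f k (x i)|)
          ∂(Measure.pi fun _ => μ) := by
  set m : Measure (Fin n → S) := Measure.pi fun _ => μ
  set Ψ : (Fin n → S) × (Fin n → S) → ℝ := fun p => ⨆ k, |∑ i, (f k (p.1 i) - f k (p.2 i))|
    with hΨ
  have hbd : ∀ k (p : (Fin n → S) × (Fin n → S)),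
      |(|∑ i, (f k (p.1 i) - f k (p.2 i))|)| ≤ n * (B + B) := fun k p => by
    rw [abs_abs]
    exact abs_sum_le_of_abs_le fun i => (abs_sub _ _).trans (add_le_add (hB k _) (hB k _))
  have hmk : ∀ k, Measurable fun p : (Fin n → S) × (Fin n → S) =>
      |∑ i, (f k (p.1 i) - f k (p.2 i))| := fun k => by
    have := hf k
    fun_prop
  have hΨi : Integrable Ψ (m.prod m) := integrable_iSup_of_abs_le _ hmk hbd
  have hΨx : ∀ x, Integrable (fun x' => Ψ (x, x')) m := fun x =>
    integrable_iSup_of_abs_le _ (fun k => (hmk k).comp measurable_prodMk_left)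
      fun k x' => hbd k (x, x')
  have hfi : ∀ k i, Integrable (fun x' : Fin n → S => f k (x' i)) m := fun k i =>
    Integrable.of_bound ((hf k).comp (measurable_pi_apply i)).aestronglyMeasurable B
      (ae_of_all _ fun x => hB k _)
  have hfe : ∀ k i, ∫ x' : Fin n → S, f k (x' i) ∂m = ∫ x, f k x ∂μ := by
    intro k i
    have he := measurePreserving_eval (fun _ : Fin n => μ) i
    conv_rhs => rw [← he.map_eq]
    rw [integral_map he.measurable.aemeasurable (hf k).aestronglyMeasurable]
  have hpt : ∀ x, ⨆ k, ∑ i, f k (x i) ≤ n * v + ∫ x', Ψ (x, x') ∂m := by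
    intro x
    refine ciSup_le fun k => ?_
    have h1 : ∫ x' : Fin n → S, ∑ i, (f k (x i) - f k (x' i)) ∂m
        = ∑ i, f k (x i) - n * ∫ x, f k x ∂μ := by
      have hi : ∀ i, Integrable (fun x' : Fin n → S => f k (x i) - f k (x' i)) m := fun i =>
        (integrable_const _).sub (hfi k i)
      rw [integral_finsetSum _ fun i _ => hi i]
      simp_rw [integral_sub (integrable_const _) (hfi k _), hfe]
      simp [Finset.sum_sub_distrib]
    have h2 : ∫ x' : Fin n → S, ∑ i, (f k (x i) - f k (x' i)) ∂m ≤ ∫ x', Ψ (x, x') ∂m := by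
      refine integral_mono (integrable_finsetSum _ fun i _ => (integrable_const _).sub (hfi k i))
        (hΨx x) fun x' => (le_abs_self _).trans ?_
      exact le_ciSup (bddAbove_range_of_abs_le fun k => hbd k (x, x')) k
    have h3 : (n : ℝ) * ∫ x, f k x ∂μ ≤ n * v := by
      have := hv k
      gcongr
    linarith
  calc ∫ x, ⨆ k, ∑ i, f k (x i) ∂m ≤ ∫ x, (n * v + ∫ x', Ψ (x, x') ∂m) ∂m := by
        refine integral_mono (integrable_iSup_of_abs_le _ (fun k => ?_) (B := n * B)
          fun k x => abs_sum_le_of_abs_le fun i => hB k _)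
          ((integrable_const _).add hΨi.integral_prod_left) hpt
        have := hf k
        fun_prop
    _ = n * v + ∫ p, Ψ p ∂(m.prod m) := by
        rw [integral_add (integrable_const _) hΨi.integral_prod_left, integral_prod _ hΨi]
        simp
    _ ≤ _ := by
        have h := (measurePreserving_arrowProdEquivProdArrow S S (Fin n) (fun _ => μ)
          (fun _ => μ)).integral_comp' Ψ
        rw [← h]
        exact add_le_add_right (integral_iSup_abs_sum_sub_le hf hB) _

end Symmetrization

/-! ### From the random sample to product measures. -/

section Sample

variable {Ω : Type v} [MeasurableSpace Ω] {P : Measure Ω} [IsProbabilityMeasure P]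
  {S : Type u} [MeasurableSpace S] {μ : Measure S} {n : ℕ} {X : Fin n → Ω → S}
  {ε : Fin n → Ω → ℝ}

lemma lintegral_rademacher_eq (h : IsSymmetrizedSample P μ X ε) {F : (Fin n → ℝ) → ℝ≥0∞}
    (hF : Measurable F) :
    ∫⁻ e, F e ∂(P.map fun ω i => ε i ω)
      = (∑ s : Fin n → Bool, F fun i => boolSign (s i)) / 2 ^ n := by
  set ρ : Measure Bool := (1 / 2 : ℝ≥0∞) • (Measure.dirac true + Measure.dirac false) with hρ
  have hρ1 : ∀ b, ρ {b} = 1 / 2 := by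
    intro b
    cases b <;> simp [hρ]
  have : IsProbabilityMeasure ρ := ⟨by
    simp [hρ, ENNReal.inv_two_add_inv_two]⟩
  have hsm : Measurable boolSign := measurable_from_top
  have hmap : ∀ i, P.map (ε i) = ρ.map boolSign := by
    intro i
    have hd : Disjoint {ω | ε i ω = 1} {ω | ε i ω = -1} := by
      refine Set.disjoint_left.2 fun ω h1 h2 => ?_
      simp only [Set.mem_ofPred_eq] at h1 h2
      linarith
    have hm1 : MeasurableSet {ω | ε i ω = 1} := h.measurable_ε i (measurableSet_singleton 1)
    have hm2 : MeasurableSet {ω | ε i ω = -1} := h.measurable_ε i (measurableSet_singleton (-1))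
    -- The two prescribed probabilities sum to `1`, so no other value has mass.
    have hae : ∀ᵐ ω ∂P, ω ∈ {ω | ε i ω = 1} ∪ {ω | ε i ω = -1} := by
      refine (prob_compl_eq_zero_iff (hm1.union hm2)).2 ?_
      rw [measure_union hd hm2, h.prob_ε_one, h.prob_ε_neg_one, ENNReal.add_halves]
    ext A hA
    rw [Measure.map_apply (h.measurable_ε i) hA, Measure.map_apply hsm hA]
    have e1 : P (ε i ⁻¹' A) = P ({ω | ε i ω = 1 ∧ (1 : ℝ) ∈ A} ∪
        {ω | ε i ω = -1 ∧ (-1 : ℝ) ∈ A}) := by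
      refine measure_congr ?_
      filter_upwards [hae] with ω hω
      refine propext ?_
      change ε i ω ∈ A ↔ (ε i ω = 1 ∧ (1 : ℝ) ∈ A) ∨ (ε i ω = -1 ∧ (-1 : ℝ) ∈ A)
      rcases hω with hω | hω <;> simp only [Set.mem_ofPred_eq] at hω <;> rw [hω] <;> norm_num
    rw [e1]
    by_cases h1 : (1 : ℝ) ∈ A <;> by_cases h2 : (-1 : ℝ) ∈ A <;>
      simp [h1, h2, hρ, boolSign, Set.indicator, measure_union hd hm2, h.prob_ε_one,
        h.prob_ε_neg_one]
  have hpi : (P.map fun ω i => ε i ω)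
      = (Measure.pi fun _ : Fin n => ρ).map fun s i => boolSign (s i) := by
    rw [(iIndepFun_iff_map_fun_eq_pi_map fun i => (h.measurable_ε i).aemeasurable).1 h.indep_ε]
    simp_rw [hmap]
    have : IsProbabilityMeasure (ρ.map boolSign) :=
      Measure.isProbabilityMeasure_map hsm.aemeasurable
    exact (measurePreserving_pi (fun _ : Fin n => ρ) (fun _ => ρ.map boolSign)
      fun _ => hsm.measurePreserving ρ).map_eq.symm
  rw [hpi, lintegral_map hF (by fun_prop), lintegral_fintype]
  simp only [Measure.pi_singleton, hρ1, Finset.prod_const, Finset.card_univ, Fintype.card_fin]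
  rw [← Finset.sum_mul, div_eq_mul_inv, div_eq_mul_inv, one_mul, ENNReal.inv_pow]

/-- Fubini for the symmetrized sample. -/
lemma lintegral_symmetrizedSample_eq [IsProbabilityMeasure μ] (h : IsSymmetrizedSample P μ X ε)
    {F : (Fin n → S) × (Fin n → ℝ) → ℝ≥0∞} (hF : Measurable F) :
    ∫⁻ ω, F (fun i => X i ω, fun i => ε i ω) ∂P
      = ∫⁻ x, (∑ s : Fin n → Bool, F (x, fun i => boolSign (s i))) / 2 ^ n
          ∂(Measure.pi fun _ => μ) := by
  have hX : Measurable fun ω i => X i ω := measurable_pi_iff.2 h.measurable_X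
  have hε : Measurable fun ω i => ε i ω := measurable_pi_iff.2 h.measurable_ε
  have hmX : (P.map fun ω i => X i ω) = Measure.pi fun _ => μ := by
    rw [(iIndepFun_iff_map_fun_eq_pi_map fun i => (h.measurable_X i).aemeasurable).1 h.indep_X]
    simp_rw [h.map_X]
  have hprod := (indepFun_iff_map_prod_eq_prod_map_map hX.aemeasurable hε.aemeasurable).1
    h.indep_X_ε
  have : IsProbabilityMeasure (P.map fun ω i => ε i ω) :=
    Measure.isProbabilityMeasure_map hε.aemeasurable
  rw [← lintegral_map (f := F) (g := fun ω => (fun i => X i ω, fun i => ε i ω)) hF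
    (hX.prodMk hε), hprod, lintegral_prod _ hF.aemeasurable, hmX]
  refine lintegral_congr fun x => ?_
  exact lintegral_rademacher_eq h (hF.comp measurable_prodMk_left)

/-- The Rademacher moment of a class with a countable dense sequence of bounded functions is
controlled by the averages over signs. -/
lemma rademacherMoment_le [IsProbabilityMeasure μ] (h : IsSymmetrizedSample P μ X ε)
    {𝒢 : Set (S → ℝ)} {f : ℕ → S → ℝ} {B : ℝ} (hf : ∀ k, Measurable (f k))
    (hB : ∀ k x, |f k x| ≤ B)
    (hd : ∀ g ∈ 𝒢, ∃ p : ℕ → ℕ, ∀ x, Tendsto (fun m => f (p m) x) atTop (𝓝 (g x))) :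
    rademacherMoment P 𝒢 X ε
      ≤ ENNReal.ofReal (∫ x : Fin n → S, signAvg (fun s => ⨆ k, |signSum s fun i => f k (x i)|)
          ∂(Measure.pi fun _ => μ)) := by
  set F : (Fin n → S) × (Fin n → ℝ) → ℝ≥0∞ := fun p =>
    ⨆ k, ENNReal.ofReal |∑ i, p.2 i * f k (p.1 i)| with hFdef
  have hF : Measurable F := by
    refine Measurable.iSup fun k => ?_
    have := hf k
    fun_prop
  -- For each `ω` the supremum over the possibly uncountable class is bounded by the one over the
  -- sequence, which is measurable.
  have h1 : rademacherMoment P 𝒢 X ε ≤ ∫⁻ ω, F (fun i => X i ω, fun i => ε i ω) ∂P := by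
    refine lintegral_mono fun ω => iSup₂_le fun g hg => ?_
    obtain ⟨p, hp⟩ := hd g hg
    have ht : Tendsto (fun m => ENNReal.ofReal |∑ i, ε i ω * f (p m) (X i ω)|) atTop
        (𝓝 (ENNReal.ofReal |∑ i, ε i ω * g (X i ω)|)) :=
      ENNReal.tendsto_ofReal
        (tendsto_finsetSum _ fun i _ => (hp (X i ω)).const_mul (ε i ω)).abs
    exact le_of_tendsto' ht fun m =>
      le_iSup (fun k => ENNReal.ofReal |∑ i, ε i ω * f k (X i ω)|) (p m)
  have hint := integrable_signAvg (integrable_iSup_abs_signSum (μ := μ) (n := n) hf hB)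
  refine h1.trans ?_
  rw [lintegral_symmetrizedSample_eq h hF, ofReal_integral_eq_lintegral_ofReal hint
    (ae_of_all _ fun x => signAvg_nonneg fun s => Real.iSup_nonneg fun k => abs_nonneg _)]
  refine lintegral_mono fun x => ?_
  beta_reduce
  rw [signAvg, ENNReal.ofReal_div_of_pos (by positivity), ENNReal.ofReal_pow (by norm_num),
    ENNReal.ofReal_sum_of_nonneg fun s _ => Real.iSup_nonneg fun k => abs_nonneg _]
  simp only [ENNReal.ofReal_ofNat]
  gcongr with s
  refine iSup_le fun k => ENNReal.ofReal_le_ofReal ?_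
  exact le_ciSup (f := fun k => |signSum s fun i => f k (x i)|)
    (bddAbove_range_of_abs_le (B := n * B) fun k => by
      rw [abs_abs]; exact abs_signSum_le_of_abs_le s fun i => hB k _) k

end Sample

/-! ### Covers at a sample from uniform entropy. -/

section Empirical

variable {S : Type u} [MeasurableSpace S] {n : ℕ}

/-- The empirical measure of the points `x₁, …, xₙ`. -/
noncomputable def empiricalMeasure (x : Fin n → S) : Measure S :=
  (n : ℝ≥0∞)⁻¹ • ∑ i, Measure.dirac (x i)

lemma isProbabilityMeasure_empiricalMeasure (hn : 0 < n) (x : Fin n → S) :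
    IsProbabilityMeasure (empiricalMeasure x) := by
  refine ⟨?_⟩
  simp only [empiricalMeasure, Measure.smul_apply, Measure.finsetSum_apply, measure_univ,
    Finset.sum_const, Finset.card_univ, Fintype.card_fin, smul_eq_mul, nsmul_eq_mul, mul_one]
  exact ENNReal.inv_mul_cancel (by exact_mod_cast hn.ne') (ENNReal.natCast_ne_top n)

lemma integrable_empiricalMeasure (hn : 0 < n) (x : Fin n → S) {u : S → ℝ}
    (hu : StronglyMeasurable u) : Integrable u (empiricalMeasure x) := by
  refine Integrable.smul_measure ?_ (ENNReal.inv_ne_top.2 (by exact_mod_cast hn.ne'))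
  exact integrable_finsetSum_measure.2 fun i _ => integrable_dirac' hu enorm_lt_top

lemma integral_empiricalMeasure (x : Fin n → S) {u : S → ℝ} (hu : StronglyMeasurable u) :
    ∫ y, u y ∂(empiricalMeasure x) = (∑ i, u (x i)) / n := by
  rw [empiricalMeasure, integral_smul_measure,
    integral_finsetSum_measure fun i _ => integrable_dirac' hu enorm_lt_top]
  simp_rw [integral_dirac' _ _ hu]
  simp [div_eq_inv_mul]

/-- Singletons need not be measurable; but a measurable null set contains no sample point, since
each carries mass `1 / n`. -/
lemma apply_eq_of_ae_empiricalMeasure {x : Fin n → S} {u w : S → ℝ}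
    (h : u =ᵐ[empiricalMeasure x] w) (i : Fin n) : u (x i) = w (x i) := by
  obtain ⟨N, hN, hNm, hN0⟩ := exists_measurable_superset_of_null (ae_iff.1 h)
  by_contra hne
  have hx : x i ∈ N := hN hne
  have h0 : (Measure.dirac (x i)) N = 0 := by
    rw [empiricalMeasure, Measure.smul_apply, smul_eq_mul, mul_eq_zero] at hN0
    rcases hN0 with h' | h'
    · simp at h'
    · rw [Measure.finsetSum_apply] at h'
      exact (Finset.sum_eq_zero_iff.1 h') i (Finset.mem_univ i)
  rw [Measure.dirac_apply' _ hNm] at h0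
  simp [hx] at h0

lemma sum_sq_le_of_eLpNorm_lt (hn : 0 < n) {x : Fin n → S} {u : S → ℝ} {r : ℝ} (hr : 0 < r)
    (hu : AEStronglyMeasurable u (empiricalMeasure x))
    (h : eLpNorm u 2 (empiricalMeasure x) < ENNReal.ofReal r) :
    ∑ i, u (x i) ^ 2 ≤ n * r ^ 2 := by
  have hn' : (0 : ℝ) < n := by exact_mod_cast hn
  have hmk : StronglyMeasurable fun y => hu.mk u y ^ 2 := hu.stronglyMeasurable_mk.pow 2
  -- Centres are only almost everywhere measurable; the measurable version agrees with `u` at every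
  -- sample point.
  rw [eLpNorm_congr_ae hu.ae_eq_mk] at h
  have hL : MemLp (hu.mk u) 2 (empiricalMeasure x) :=
    ⟨hu.stronglyMeasurable_mk.aestronglyMeasurable, h.trans ENNReal.ofReal_lt_top⟩
  rw [hL.eLpNorm_eq_integral_rpow_norm (by norm_num) (by norm_num),
    ENNReal.ofReal_lt_ofReal_iff hr] at h
  simp only [ENNReal.toReal_ofNat, Real.norm_eq_abs, Real.rpow_two, sq_abs] at h
  rw [integral_empiricalMeasure x hmk, ← one_div, ← Real.sqrt_eq_rpow,
    Real.sqrt_lt' hr, div_lt_iff₀ hn'] at h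
  simp_rw [apply_eq_of_ae_empiricalMeasure hu.ae_eq_mk]
  linarith

lemma exists_finset_of_coveringNumber_le {r c : ℝ} {𝒢 : Set (S → ℝ)} {Q : Measure S} (hc : 0 ≤ c)
    (h : (coveringNumber r 𝒢 Q : ℝ≥0∞) ≤ ENNReal.ofReal c) :
    ∃ T : Finset (S → ℝ), (T.card : ℝ) ≤ c ∧ (∀ h ∈ T, MemLp h 2 Q) ∧
      ∀ g ∈ 𝒢, ∃ h ∈ T, eLpNorm (fun x => g x - h x) 2 Q < ENNReal.ofReal r := by
  have hlt : coveringNumber r 𝒢 Q < (⌊c⌋₊ + 1 : ℕ) := by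
    by_contra hge
    rw [not_lt] at hge
    have h1 : (((⌊c⌋₊ + 1 : ℕ) : ℕ∞) : ℝ≥0∞) ≤ ENNReal.ofReal c :=
      le_trans (by exact_mod_cast hge) h
    rw [ENat.toENNReal_coe, ← ENNReal.ofReal_natCast, ENNReal.ofReal_le_ofReal_iff hc] at h1
    have := Nat.lt_floor_add_one c
    push_cast at h1
    linarith
  simp only [coveringNumber, iInf_lt_iff] at hlt
  obtain ⟨T, hT, hcov, hcard⟩ := hlt
  have h2 : T.card ≤ ⌊c⌋₊ := Nat.lt_succ_iff.1 (by exact_mod_cast hcard)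
  exact ⟨T, (Nat.le_floor_iff hc).1 h2, hT, hcov⟩

variable {μ : Measure S} {𝒢 : Set (S → ℝ)} {G : S → ℝ} {C ν β : ℝ}

/-- Uniform entropy gives internal covers of a sequence of class members at any sample. -/
lemma IsUniformEntropyClass.exists_finset_cover (hE : IsUniformEntropyClass μ 𝒢 G C ν β)
    {f : ℕ → S → ℝ} (hf : ∀ k, f k ∈ 𝒢) (x : Fin n → S) {R : ℝ} (hR : 0 < R)
    (hG : ∑ i, G (x i) ^ 2 = R ^ 2) {r : ℝ} (hr : 0 < r) (hrR : r ≤ R) :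
    ∃ F : Finset ℕ, (F.card : ℝ) ≤ C * (2 * R / r) ^ ν ∧
      ∀ k, ∃ j ∈ F, ∑ i, (f k (x i) - f j (x i)) ^ 2 ≤ r ^ 2 := by
  classical
  have hn : 0 < n := by
    rcases Nat.eq_zero_or_pos n with rfl | h
    · simp only [Finset.univ_eq_empty, Finset.sum_empty] at hG
      nlinarith
    · exact h
  have hn' : (0 : ℝ) < n := by exact_mod_cast hn
  have hC := hE.one_le_C
  have hQ := isProbabilityMeasure_empiricalMeasure hn x
  have hGm : StronglyMeasurable fun y => G y ^ 2 :=
    (hE.envelope_measurable.pow_const 2).stronglyMeasurable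
  have hint : ∫ y, G y ^ 2 ∂(empiricalMeasure x) = R ^ 2 / n := by
    rw [integral_empiricalMeasure x hGm, hG]
  -- Half the target radius, since moving the centres into the class doubles it; this also makes `η
  -- < 1` when `r = R`.
  set η := r / (2 * R) with hη
  have hη0 : 0 < η := by positivity
  have hη1 : η < 1 := by
    rw [hη, div_lt_one (by positivity)]
    linarith
  have hrad : η * √(∫ y, G y ^ 2 ∂(empiricalMeasure x)) = r / (2 * √n) := by
    rw [hint, Real.sqrt_div (sq_nonneg R), Real.sqrt_sq hR.le, hη]
    field_simp
  have hcn : (coveringNumber (r / (2 * √n)) 𝒢 (empiricalMeasure x) : ℝ≥0∞)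
      ≤ ENNReal.ofReal (C * η ^ (-ν)) := by
    refine le_trans ?_ (hE.entropy η hη0 hη1)
    rw [← hrad]
    refine ENat.toENNReal_le.2 ?_
    exact le_iSup_of_le (empiricalMeasure x) (le_iSup_of_le hQ
      (le_iSup_of_le (integrable_empiricalMeasure hn x hGm)
        (le_iSup_of_le (by rw [hint]; positivity) le_rfl)))
  obtain ⟨T, hTc, hTm, hT⟩ := exists_finset_of_coveringNumber_le (by positivity) hcn
  have hclose : ∀ k, ∀ h ∈ T, eLpNorm (fun y => f k y - h y) 2 (empiricalMeasure x)
      < ENNReal.ofReal (r / (2 * √n)) → ∑ i, (f k (x i) - h (x i)) ^ 2 ≤ (r / 2) ^ 2 := by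
    intro k h hh hlt
    refine (sum_sq_le_of_eLpNorm_lt hn (by positivity)
      ((hE.pointwiseMeasurable.1 _ (hf k)).aestronglyMeasurable.sub (hTm h hh).1) hlt).trans ?_
    rw [div_pow, mul_pow, Real.sq_sqrt hn'.le, div_pow]
    apply le_of_eq
    field_simp
  -- Replaces a centre by a nearby member of the sequence. The default `0` is taken only at centres
  -- close to no member, which are never used.
  let p : (S → ℝ) → ℕ := fun h =>
    if H : ∃ k, ∑ i, (f k (x i) - h (x i)) ^ 2 ≤ (r / 2) ^ 2 then H.choose else 0
  refine ⟨T.image p, ?_, fun k => ?_⟩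
  · refine le_trans (by exact_mod_cast Finset.card_image_le) (hTc.trans (le_of_eq ?_))
    rw [hη, Real.rpow_neg (by positivity), ← Real.inv_rpow (by positivity), inv_div]
  · obtain ⟨h, hh, hlt⟩ := hT (f k) (hf k)
    have h1 := hclose k h hh hlt
    refine ⟨p h, Finset.mem_image_of_mem p hh, ?_⟩
    have H : ∃ k, ∑ i, (f k (x i) - h (x i)) ^ 2 ≤ (r / 2) ^ 2 := ⟨k, h1⟩
    have h2 : ∑ i, (f (p h) (x i) - h (x i)) ^ 2 ≤ (r / 2) ^ 2 := by
      simp only [p, dif_pos H]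
      exact H.choose_spec
    have h3 : ∑ i, (h (x i) - f (p h) (x i)) ^ 2 ≤ (r / 2) ^ 2 := by
      simpa only [← neg_sub (f (p h) _), neg_sq] using h2
    have h4 := sum_add_sq_le _ _ (by positivity) (by positivity) h1 h3
    simpa only [sub_add_sub_cancel, add_halves] using h4

end Empirical

/-! ### Constants and scalar inequalities. -/

lemma exp_one_le_C₁ (C ν : ℝ) : Real.exp 1 ≤ C₁ C ν := le_max_right _ _

lemma C₁_pos (C ν : ℝ) : 0 < C₁ C ν := (Real.exp_pos 1).trans_le (exp_one_le_C₁ C ν)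

lemma le_C₁_rpow {C ν : ℝ} (hC : 1 ≤ C) (hν : 1 ≤ ν) : C ≤ C₁ C ν ^ ν := by
  have hC0 : 0 ≤ C := by linarith
  calc C = (C ^ (1 / ν)) ^ ν := by
        rw [← Real.rpow_mul hC0, one_div_mul_cancel (by linarith), Real.rpow_one]
    _ ≤ C₁ C ν ^ ν :=
        Real.rpow_le_rpow (Real.rpow_nonneg hC0 _) (le_max_left _ _) (by linarith)

lemma one_le_log_C₁_mul_div {C ν β σ : ℝ} (hσ : 0 < σ) (hσβ : σ ≤ β) :
    1 ≤ Real.log (C₁ C ν * β / σ) := by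
  have hc := C₁_pos C ν
  have hβ := hσ.trans_le hσβ
  rw [Real.le_log_iff_exp_le (by positivity), le_div_iff₀ hσ]
  have := exp_one_le_C₁ C ν
  gcongr

/-- Split off `log t` with `t = Rσ / (Dβ)` and use `2 log t ≤ t²`; the factor `D²` cancels the
denominator of `t²`. -/
lemma sq_mul_log_le {c D R β σ : ℝ} (hc : 0 < c) (hD : 0 < D) (hR : 0 < R) (hβ : 0 < β)
    (hσ : 0 < σ) :
    D ^ 2 * Real.log (c * R / D)
      ≤ D ^ 2 * Real.log (c * β / σ) + R ^ 2 * (σ ^ 2 / (2 * β ^ 2)) := by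
  have h1 : Real.log (c * R / D) = Real.log (c * β / σ) + Real.log (R * σ / (D * β)) := by
    rw [← Real.log_mul (by positivity) (by positivity)]
    congr 1
    field_simp
  have h2 : 2 * Real.log (R * σ / (D * β)) ≤ (R * σ / (D * β)) ^ 2 := by
    have := Real.log_le_sub_one_of_pos (show 0 < (R * σ / (D * β)) ^ 2 by positivity)
    rw [Real.log_pow] at this
    push_cast at this
    linarith
  have h3 : D ^ 2 * (R * σ / (D * β)) ^ 2 = 2 * (R ^ 2 * (σ ^ 2 / (2 * β ^ 2))) := by
    field_simp
  have h4 := mul_le_mul_of_nonneg_left h2 (sq_nonneg D)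
  rw [h1]
  linarith

lemma integrable_sqrt {α : Type*} [MeasurableSpace α] {m : Measure α} [IsFiniteMeasure m]
    {q : α → ℝ} (hq : Integrable q m) (h0 : ∀ x, 0 ≤ q x) : Integrable (fun x => √(q x)) m := by
  refine (hq.add (integrable_const 1)).mono'
    (Real.continuous_sqrt.comp_aestronglyMeasurable hq.aestronglyMeasurable)
    (ae_of_all _ fun x => ?_)
  rw [Real.norm_eq_abs, abs_of_nonneg (Real.sqrt_nonneg _)]
  change √(q x) ≤ q x + 1
  nlinarith [Real.sq_sqrt (h0 x), sq_nonneg (√(q x) - 1), Real.sqrt_nonneg (q x)]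

/-- Integrate `0 ≤ (√q - w)²`. -/
lemma integral_sqrt_sq_le {α : Type*} [MeasurableSpace α] {m : Measure α} [IsProbabilityMeasure m]
    {q : α → ℝ} (hq : Integrable q m) (h0 : ∀ x, 0 ≤ q x) :
    (∫ x, √(q x) ∂m) ^ 2 ≤ ∫ x, q x ∂m := by
  have hs : Integrable (fun x => √(q x)) m := integrable_sqrt hq h0
  set w := ∫ x, √(q x) ∂m with hw
  have h1 : ∫ x, (q x - 2 * w * √(q x)) ∂m = ∫ x, q x ∂m - 2 * w * w := by
    rw [integral_sub hq (hs.const_mul _), integral_const_mul]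
  have h2 : ∫ x, -w ^ 2 ∂m ≤ ∫ x, (q x - 2 * w * √(q x)) ∂m := by
    refine integral_mono (integrable_const _) (hq.sub (hs.const_mul _)) fun x => ?_
    nlinarith [Real.sq_sqrt (h0 x), sq_nonneg (√(q x) - w)]
  rw [h1] at h2
  simp only [integral_const, probReal_univ, one_smul] at h2
  nlinarith

lemma le_add_of_sq_le {w a b : ℝ} (ha : 0 ≤ a) (hb : 0 ≤ b) (h : w ^ 2 ≤ a ^ 2 + b * w) :
    w ≤ a + b := by
  by_contra! hlt
  nlinarith

/-! ### The bound at a fixed variance level. -/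

section Class

variable {S : Type u} [MeasurableSpace S] {μ : Measure S} {n : ℕ}
  {𝒢 : Set (S → ℝ)} {G : S → ℝ} {C ν β : ℝ}

lemma IsUniformEntropyClass.sq_le (hE : IsUniformEntropyClass μ 𝒢 G C ν β) {g : S → ℝ}
    (hg : g ∈ 𝒢) (x : S) : g x ^ 2 ≤ G x ^ 2 := by
  rw [← sq_abs (g x)]
  exact pow_le_pow_left₀ (abs_nonneg _) (hE.envelope g hg x) 2

lemma IsUniformEntropyClass.integral_sq_le (hE : IsUniformEntropyClass μ 𝒢 G C ν β) {g : S → ℝ}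
    (hg : g ∈ 𝒢) : ∫ x, g x ^ 2 ∂μ ≤ β ^ 2 :=
  (integral_mono_of_nonneg (ae_of_all _ fun _ => sq_nonneg _) hE.envelope_sq_integrable
    (ae_of_all _ fun x => hE.sq_le hg x)).trans hE.envelope_sq_le

lemma IsUniformEntropyClass.integral_sq_le_sigmaZero_sq (hE : IsUniformEntropyClass μ 𝒢 G C ν β)
    {g : S → ℝ} (hg : g ∈ 𝒢) : ∫ x, g x ^ 2 ∂μ ≤ sigmaZero μ 𝒢 ^ 2 := by
  have hb : BddAbove (Set.range fun g : 𝒢 => ∫ x, (g : S → ℝ) x ^ 2 ∂μ) :=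
    ⟨β ^ 2, by rintro _ ⟨g, rfl⟩; exact hE.integral_sq_le g.2⟩
  rw [sigmaZero, Real.sq_sqrt (Real.iSup_nonneg fun g => integral_nonneg fun x => sq_nonneg _)]
  exact le_ciSup hb ⟨g, hg⟩

lemma IsUniformEntropyClass.sigmaZero_le (hE : IsUniformEntropyClass μ 𝒢 G C ν β) :
    sigmaZero μ 𝒢 ≤ β := by
  refine Real.sqrt_le_iff.2 ⟨hE.β_pos.le, ?_⟩
  exact Real.iSup_le (fun g => hE.integral_sq_le g.2) (sq_nonneg β)

lemma IsUniformEntropyClass.exists_seq (hE : IsUniformEntropyClass μ 𝒢 G C ν β)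
    (hne : 𝒢.Nonempty) : ∃ f : ℕ → S → ℝ, (∀ k, f k ∈ 𝒢) ∧
      ∀ g ∈ 𝒢, ∃ p : ℕ → ℕ, ∀ x, Tendsto (fun m => f (p m) x) atTop (𝓝 (g x)) := by
  obtain ⟨-, 𝒢₀, hsub, hcount, hdense⟩ := hE.pointwiseMeasurable
  obtain ⟨g, hg⟩ := hne
  obtain ⟨h, hh, -⟩ := hdense g hg
  obtain ⟨f, rfl⟩ := hcount.exists_eq_range ⟨h 0, hh 0⟩
  refine ⟨f, fun k => hsub (Set.mem_range_self k), fun g hg => ?_⟩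
  obtain ⟨h, hh, hlim⟩ := hdense g hg
  choose p hp using hh
  exact ⟨p, fun x => by simpa only [hp] using hlim x⟩

/-- The entropy bound at a fixed sample, with the logarithm replaced by a tangent line so that the
bound is the square root of an affine function of `sup ∑ f²` and `∑ G²`. -/
lemma IsUniformEntropyClass.signAvg_iSup_le (hE : IsUniformEntropyClass μ 𝒢 G C ν β)
    {f φ : ℕ → S → ℝ} (hf : ∀ k, f k ∈ 𝒢) {L σ : ℝ} (hL : 0 ≤ L) (hσ : 0 < σ)
    (hφ : ∀ k x, |φ k x| ≤ L * |f k x|)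
    (hφf : ∀ k j x, |φ k x - φ j x| ≤ L * |f k x - f j x|) (x : Fin n → S) :
    signAvg (fun s => ⨆ k, |signSum s fun i => φ k (x i)|)
      ≤ 48 * L * √(ν * ((⨆ k, ∑ i, f k (x i) ^ 2) * Real.log (C₁ C ν * β / σ)
          + (∑ i, G (x i) ^ 2) * (σ ^ 2 / (2 * β ^ 2)))) := by
  have hβ := hE.β_pos
  have hν := hE.one_le_ν
  set V := ⨆ k, ∑ i, f k (x i) ^ 2 with hV
  set Y := ∑ i, G (x i) ^ 2 with hY
  have hkY : ∀ k, ∑ i, f k (x i) ^ 2 ≤ Y := fun k =>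
    Finset.sum_le_sum fun i _ => hE.sq_le (hf k) _
  have hkV : ∀ k, ∑ i, f k (x i) ^ 2 ≤ V :=
    le_ciSup (f := fun k => ∑ i, f k (x i) ^ 2) ⟨Y, by rintro _ ⟨k, rfl⟩; exact hkY k⟩
  have hVY : V ≤ Y := ciSup_le hkY
  have hV0 : 0 ≤ V := (Finset.sum_nonneg fun i _ => sq_nonneg _).trans (hkV 0)
  -- Chaining needs a positive diameter; if `V = 0` the process vanishes on the sample.
  rcases hV0.eq_or_lt with h0 | hVpos
  · have hz : ∀ k i, f k (x i) = 0 := fun k i => by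
      have h1 := hkV k
      rw [← h0] at h1
      have h2 := Finset.single_le_sum (f := fun i => f k (x i) ^ 2) (fun i _ => sq_nonneg _)
        (Finset.mem_univ i)
      exact pow_eq_zero_iff two_ne_zero |>.1 (le_antisymm (h2.trans h1) (sq_nonneg _))
    have hφz : ∀ k i, φ k (x i) = 0 := fun k i => by
      have := hφ k (x i)
      rw [hz, abs_zero, mul_zero] at this
      exact abs_nonpos_iff.1 this
    simp only [hφz, signSum, mul_zero, Finset.sum_const_zero, abs_zero, ciSup_const, signAvg_const]
    positivity
  · have hYpos := hVpos.trans_le hVY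
    have hD := Real.sqrt_pos.2 hVpos
    have hR := Real.sqrt_pos.2 hYpos
    have hDV := Real.sq_sqrt hVpos.le
    have hRY := Real.sq_sqrt hYpos.le
    refine (signAvg_iSup_le_of_covering (fun k i => f k (x i)) (fun k i => φ k (x i))
      hE.one_le_C hν (exp_one_le_C₁ C ν) (le_C₁_rpow hE.one_le_C hν) hD
      (Real.sqrt_le_sqrt hVY) hL (fun k i => hφ k _) (fun k j i => hφf k j _)
      (fun k => by rw [hDV]; exact hkV k)
      (fun r hr hrR => hE.exists_finset_cover hf x hR hRY.symm hr hrR)).trans ?_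
    have := sq_mul_log_le (C₁_pos C ν) hD hR hβ hσ
    rw [hDV, hRY] at this
    rw [hDV]
    gcongr

variable [IsProbabilityMeasure μ]

/-- Bound on the Rademacher moment at an arbitrary variance level `σ`. -/
lemma IsUniformEntropyClass.rademacherMoment_le_of_sigmaZero_le {Ω : Type v} [MeasurableSpace Ω]
    {P : Measure Ω} [IsProbabilityMeasure P] {X : Fin n → Ω → S} {ε : Fin n → Ω → ℝ}
    (hX : IsSymmetrizedSample P μ X ε) (hE : IsUniformEntropyClass μ 𝒢 G C ν β) {U σ : ℝ}
    (hU : 0 ≤ U) (hgU : ∀ g ∈ 𝒢, ∀ x, |g x| ≤ U) (hσ : 0 < σ) (hσβ : σ ≤ β)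
    (hσ₀ : sigmaZero μ 𝒢 ^ 2 ≤ σ ^ 2) :
    rademacherMoment P 𝒢 X ε
      ≤ ENNReal.ofReal (9216 * (√(ν * n * σ ^ 2 * Real.log (C₁ C ν * β / σ))
          + ν * U * Real.log (C₁ C ν * β / σ))) := by
  rcases 𝒢.eq_empty_or_nonempty with rfl | hne
  · simp [rademacherMoment]
  obtain ⟨f, hf, hd⟩ := hE.exists_seq hne
  have hβ := hE.β_pos
  have hν := hE.one_le_ν
  set l := Real.log (C₁ C ν * β / σ) with hl
  have hl1 : 1 ≤ l := one_le_log_C₁_mul_div hσ hσβ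
  have hfm : ∀ k, Measurable (f k) := fun k => hE.pointwiseMeasurable.1 _ (hf k)
  have hfU : ∀ k x, |f k x| ≤ U := fun k => hgU _ (hf k)
  set m : Measure (Fin n → S) := Measure.pi fun _ => μ with hm
  set V : (Fin n → S) → ℝ := fun x => ⨆ k, ∑ i, f k (x i) ^ 2 with hV
  set q : (Fin n → S) → ℝ := fun x =>
    ν * (V x * l + (∑ i, G (x i) ^ 2) * (σ ^ 2 / (2 * β ^ 2))) with hq
  have hfsq : ∀ k x, |f k x ^ 2| ≤ U ^ 2 := fun k x => by
    rw [abs_pow]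
    exact pow_le_pow_left₀ (abs_nonneg _) (hfU k x) 2
  have hVi : Integrable V m := by
    refine integrable_iSup_of_abs_le _ (fun k => ?_) (B := n * U ^ 2) fun k x =>
      abs_sum_le_of_abs_le fun i => hfsq k _
    have := hfm k
    fun_prop
  have hGi : ∀ i, Integrable (fun x : Fin n → S => G (x i) ^ 2) m := fun i =>
    (measurePreserving_eval (fun _ : Fin n => μ) i).integrable_comp_of_integrable
      hE.envelope_sq_integrable
  have hGe : ∀ i, ∫ x : Fin n → S, G (x i) ^ 2 ∂m ≤ β ^ 2 := fun i => by
    have he := measurePreserving_eval (fun _ : Fin n => μ) i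
    have h1 := hE.envelope_sq_le
    rw [← he.map_eq, integral_map he.measurable.aemeasurable
      (hE.envelope_measurable.pow_const 2).aestronglyMeasurable] at h1
    exact h1
  have hGsi : Integrable (fun x : Fin n → S => ∑ i, G (x i) ^ 2) m :=
    integrable_finsetSum _ fun i _ => hGi i
  have hqi : Integrable q m := ((hVi.mul_const _).add (hGsi.mul_const _)).const_mul _
  have hq0 : ∀ x, 0 ≤ q x := fun x => by
    have h1 : 0 ≤ V x := Real.iSup_nonneg fun k => Finset.sum_nonneg fun i _ => sq_nonneg _
    positivity
  set w := ∫ x, √(q x) ∂m with hw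
  have hsi : Integrable (fun x => √(q x)) m := integrable_sqrt hqi hq0
  -- Used twice: with `φ = f²`, `L = 2U` to bound `V`, and with `φ = f`, `L = 1` for the conclusion.
  have hbound : ∀ (φ : ℕ → S → ℝ) (L B : ℝ), 0 ≤ L → (∀ k, Measurable (φ k)) →
      (∀ k x, |φ k x| ≤ B) → (∀ k x, |φ k x| ≤ L * |f k x|) →
      (∀ k j x, |φ k x - φ j x| ≤ L * |f k x - f j x|) →
      ∫ x : Fin n → S, signAvg (fun s => ⨆ k, |signSum s fun i => φ k (x i)|) ∂m
        ≤ 48 * L * w := by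
    intro φ L B hL hφm hφB hφ hφf
    rw [hw, ← integral_const_mul]
    exact integral_mono (integrable_signAvg (integrable_iSup_abs_signSum hφm hφB))
      (hsi.const_mul _) fun x => hE.signAvg_iSup_le hf hL hσ hφ hφf x
  have hVle : ∫ x, V x ∂m ≤ n * σ ^ 2 + 192 * U * w := by
    have h1 := integral_iSup_sum_le (μ := μ) (n := n) (f := fun k x => f k x ^ 2)
      (fun k => (hfm k).pow_const 2) hfsq
      (fun k => (hE.integral_sq_le_sigmaZero_sq (hf k)).trans hσ₀)
    have h2 := hbound (fun k x => f k x ^ 2) (2 * U) (U ^ 2) (by positivity)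
      (fun k => (hfm k).pow_const 2) hfsq
      (fun k x => by
        rw [abs_pow, sq]
        have := hfU k x
        gcongr
        linarith)
      (fun k j x => by
        rw [sq_sub_sq, abs_mul]
        have h3 := (abs_add_le (f k x) (f j x)).trans (add_le_add (hfU k x) (hfU j x))
        gcongr
        linarith)
    linarith
  have hqle : ∫ x, q x ∂m ≤ 2 * (ν * n * σ ^ 2 * l) + 192 * ν * U * l * w := by
    have h1 : ∫ x, q x ∂m = ν * ((∫ x, V x ∂m) * l
        + (∑ i, ∫ x : Fin n → S, G (x i) ^ 2 ∂m) * (σ ^ 2 / (2 * β ^ 2))) := by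
      rw [integral_const_mul, integral_add (hVi.mul_const _) (hGsi.mul_const _),
        integral_mul_const, integral_mul_const, integral_finsetSum _ fun i _ => hGi i]
    have h2 : (∑ i, ∫ x : Fin n → S, G (x i) ^ 2 ∂m) * (σ ^ 2 / (2 * β ^ 2)) ≤ n * σ ^ 2 * l := by
      calc (∑ i, ∫ x : Fin n → S, G (x i) ^ 2 ∂m) * (σ ^ 2 / (2 * β ^ 2))
          ≤ (n * β ^ 2) * (σ ^ 2 / (2 * β ^ 2)) := by
            gcongr
            refine (Finset.sum_le_sum fun i _ => hGe i).trans ?_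
            simp
        _ = n * σ ^ 2 * (1 / 2) := by field_simp
        _ ≤ n * σ ^ 2 * l := by gcongr; linarith
    have h3 : (∫ x, V x ∂m) * l ≤ (n * σ ^ 2 + 192 * U * w) * l := by gcongr
    calc ∫ x, q x ∂m ≤ ν * ((n * σ ^ 2 + 192 * U * w) * l + n * σ ^ 2 * l) := by
          rw [h1]
          gcongr
      _ = _ := by ring
  -- The inequality for `w` is self-referential, as `E q` is bounded in terms of `w`; solving the
  -- quadratic closes the loop. Finally `48 * 192 = 9216`.
  have hwle : w ≤ √(2 * (ν * n * σ ^ 2 * l)) + 192 * ν * U * l := by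
    refine le_add_of_sq_le (Real.sqrt_nonneg _) (by positivity) ?_
    rw [Real.sq_sqrt (by positivity)]
    exact (integral_sqrt_sq_le hqi hq0).trans hqle
  refine (rademacherMoment_le hX hfm hfU hd).trans (ENNReal.ofReal_le_ofReal ?_)
  have h1 := hbound f 1 U zero_le_one hfm hfU (fun k x => by simp) (fun k j x => by simp)
  have h2 : √(2 * (ν * n * σ ^ 2 * l)) ≤ 2 * √(ν * n * σ ^ 2 * l) := by
    rw [Real.sqrt_le_left (by positivity), mul_pow, Real.sq_sqrt (by positivity)]
    have : 0 ≤ ν * n * σ ^ 2 * l := by positivity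
    linarith
  have h3 : 0 ≤ √(ν * n * σ ^ 2 * l) := Real.sqrt_nonneg _
  linarith

end Class

/-! ### The two bounds. -/

section Bounds

variable {Ω : Type v} [MeasurableSpace Ω] {P : Measure Ω} [IsProbabilityMeasure P]
  {S : Type u} [MeasurableSpace S] {μ : Measure S} [IsProbabilityMeasure μ] {n : ℕ}
  {X : Fin n → Ω → S} {ε : Fin n → Ω → ℝ} {𝒢 : Set (S → ℝ)} {G : S → ℝ} {C ν β : ℝ}

lemma IsUniformEntropyClass.rademacherMoment_le_of_le_sqrt
    (hX : IsSymmetrizedSample P μ X ε) (hE : IsUniformEntropyClass μ 𝒢 G C ν β) {σ : ℝ}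
    (hσ : 0 < σ) (hσβ : σ ≤ β) (hσ₀ : sigmaZero μ 𝒢 ^ 2 ≤ σ ^ 2)
    (hg : ∀ g ∈ 𝒢, ∀ x,
      |g x| ≤ 1 / (4 * √ν) * √(n * σ ^ 2 / Real.log (C₁ C ν * β / σ))) :
    rademacherMoment P 𝒢 X ε
      ≤ ENNReal.ofReal (18432 * √(ν * n * σ ^ 2 * Real.log (C₁ C ν * β / σ))) := by
  have hν : 0 < ν := by linarith [hE.one_le_ν]
  have hl := one_le_log_C₁_mul_div (C := C) (ν := ν) hσ hσβ
  refine (hE.rademacherMoment_le_of_sigmaZero_le hX (by positivity) hg hσ hσβ hσ₀).trans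
    (ENNReal.ofReal_le_ofReal ?_)
  set l := Real.log (C₁ C ν * β / σ)
  have hl0 : 0 < l := by linarith
  set a := √(ν * n * σ ^ 2 * l) with ha
  have ha0 : 0 ≤ a := Real.sqrt_nonneg _
  -- The assumed bound on the functions is exactly the `U` for which `ν U l` is a quarter of the
  -- main term.
  have h1 : ν * (1 / (4 * √ν) * √(n * σ ^ 2 / l)) * l = a / 4 := by
    have h2 : a = √ν * (√(n * σ ^ 2 / l) * l) := by
      have h3 : ν * n * σ ^ 2 * l = ν * ((n * σ ^ 2 / l) * l ^ 2) := by field_simp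
      rw [ha, h3, Real.sqrt_mul hν.le, Real.sqrt_mul (by positivity), Real.sqrt_sq hl0.le]
    have h4 : ν = √ν * √ν := (Real.mul_self_sqrt hν.le).symm
    have h5 : 0 < √ν := Real.sqrt_pos.2 hν
    rw [h2]
    nth_rw 1 [h4]
    field_simp
  rw [h1]
  linarith

lemma IsUniformEntropyClass.rademacherMoment_le_of_abs_le
    (hX : IsSymmetrizedSample P μ X ε) (hE : IsUniformEntropyClass μ 𝒢 G C ν β) {U : ℝ}
    (hg : ∀ g ∈ 𝒢, ∀ x, |g x| ≤ U) (hσU : sigmaZero μ 𝒢 ≤ U) (hUβ : U ≤ C₂ C ν * √n * β) :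
    rademacherMoment P 𝒢 X ε
      ≤ ENNReal.ofReal (18432 * (√(ν * n * sigmaZero μ 𝒢 ^ 2 *
            Real.log (C₁ C ν * β / sigmaZero μ 𝒢))
          + 2 * ν * U * Real.log (C₃ C ν * n * (β / U) ^ 2))) := by
  have hν : 0 < ν := by linarith [hE.one_le_ν]
  have hβ := hE.β_pos
  have hc := C₁_pos C ν
  have hσ₀ : 0 ≤ sigmaZero μ 𝒢 := Real.sqrt_nonneg _
  rcases (hσ₀.trans hσU).eq_or_lt with rfl | hU
  · have hz : ∀ g ∈ 𝒢, ∀ x, g x = 0 := fun g h x => abs_nonpos_iff.1 (hg g h x)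
    have h0 : rademacherMoment P 𝒢 X ε = 0 := by
      rw [rademacherMoment]
      refine (lintegral_congr fun ω => ?_).trans lintegral_zero
      refine le_antisymm (iSup₂_le fun g h => ?_) bot_le
      simp [hz g h]
    rw [h0]
    exact bot_le
  have hn : 0 < n := by
    rcases Nat.eq_zero_or_pos n with rfl | h
    · simp only [Nat.cast_zero, Real.sqrt_zero, mul_zero, zero_mul] at hUβ
      linarith
    · exact h
  have hn' : (0 : ℝ) < n := by exact_mod_cast hn
  have hsn : 0 < √(n : ℝ) := Real.sqrt_pos.2 hn'
  have hsν : 0 < √ν := Real.sqrt_pos.2 hν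
  have hn2 : √(n : ℝ) ^ 2 = n := Real.sq_sqrt hn'.le
  have hν2 : √ν ^ 2 = ν := Real.sq_sqrt hν.le
  -- The level at which `ν U l` is comparable to the main term up to a factor `√l`; `C₃` is chosen
  -- so that `log (C₁ β / τ) = Λ / 2`, and `U ≤ C₂ √n β` ensures `τ ≤ β`.
  set τ := 4 * √ν * U / √n with hτ
  have hτ0 : 0 < τ := by positivity
  have hlogC : 1 ≤ Real.log (C₁ C ν) := (Real.le_log_iff_exp_le hc).2 (exp_one_le_C₁ C ν)
  have hτβ : τ ≤ β := by
    rw [hτ, div_le_iff₀ hsn]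
    have h1 : C₂ C ν ≤ 1 / (4 * √ν) := by
      rw [C₂]
      gcongr
      nlinarith
    calc 4 * √ν * U ≤ 4 * √ν * (1 / (4 * √ν) * √n * β) := by
          have : C₂ C ν * √n * β ≤ 1 / (4 * √ν) * √n * β := by gcongr
          have := hUβ.trans this
          gcongr
      _ = β * √n := by field_simp
  set Λ := Real.log (C₃ C ν * n * (β / U) ^ 2) with hΛ
  have hΛτ : Real.log (C₁ C ν * β / τ) = Λ / 2 := by
    have h1 : C₃ C ν * n * (β / U) ^ 2 = (C₁ C ν * β / τ) ^ 2 := by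
      rw [C₃, hτ, div_pow _ (4 * √ν * U / √n), div_pow _ √(n : ℝ), mul_pow _ U, mul_pow 4 √ν,
        hn2, hν2]
      field_simp
      ring
    rw [hΛ, h1, Real.log_pow]
    push_cast
    ring
  have hΛ2 : 2 ≤ Λ := by
    have := one_le_log_C₁_mul_div (C := C) (ν := ν) hτ0 hτβ
    linarith
  have hν0U : 0 ≤ ν * U * Λ := by positivity
  -- Below `τ` the level is raised to `τ`, and the main term there is absorbed by `ν U Λ` because `Λ
  -- ≥ 2`. Above `τ` the level is `sigmaZero` itself, whose logarithm is at most `Λ / 2`. The first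
  -- case includes `sigmaZero = 0`.
  rcases le_or_gt (sigmaZero μ 𝒢) τ with h | h
  · refine (hE.rademacherMoment_le_of_sigmaZero_le hX hU.le hg hτ0 hτβ (by gcongr)).trans
      (ENNReal.ofReal_le_ofReal ?_)
    rw [hΛτ]
    have h1 : √(ν * n * τ ^ 2 * (Λ / 2)) ≤ 2 * (ν * U * Λ) := by
      rw [Real.sqrt_le_left (by positivity)]
      have h2 : ν * n * τ ^ 2 * (Λ / 2) = (ν * U) ^ 2 * (8 * Λ) := by
        rw [hτ, div_pow, mul_pow, mul_pow, hn2, hν2]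
        field_simp
        ring
      have h3 : 8 * Λ ≤ (2 * Λ) ^ 2 := by nlinarith
      calc ν * n * τ ^ 2 * (Λ / 2) = (ν * U) ^ 2 * (8 * Λ) := h2
        _ ≤ (ν * U) ^ 2 * (2 * Λ) ^ 2 := by gcongr
        _ = (2 * (ν * U * Λ)) ^ 2 := by ring
    have h3 : 0 ≤ √(ν * n * sigmaZero μ 𝒢 ^ 2 * Real.log (C₁ C ν * β / sigmaZero μ 𝒢)) :=
      Real.sqrt_nonneg _
    linarith
  · have hσ : 0 < sigmaZero μ 𝒢 := hτ0.trans h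
    refine (hE.rademacherMoment_le_of_sigmaZero_le hX hU.le hg hσ hE.sigmaZero_le le_rfl).trans
      (ENNReal.ofReal_le_ofReal ?_)
    have h1 : Real.log (C₁ C ν * β / sigmaZero μ 𝒢) ≤ Λ / 2 := by
      rw [← hΛτ]
      gcongr
    have h2 : ν * U * Real.log (C₁ C ν * β / sigmaZero μ 𝒢) ≤ ν * U * (Λ / 2) := by gcongr
    have h3 : 0 ≤ √(ν * n * sigmaZero μ 𝒢 ^ 2 * Real.log (C₁ C ν * β / sigmaZero μ 𝒢)) :=
      Real.sqrt_nonneg _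
    linarith

end Bounds

end EmpiricalProcess

theorem corollary4 :
    ∃ A : ℝ, 0 < A ∧
      ∀ (Ω : Type v) [MeasurableSpace Ω] (P : Measure Ω) [IsProbabilityMeasure P]
        (S : Type u) [MeasurableSpace S] (μ : Measure S) [IsProbabilityMeasure μ]
        (n : ℕ) (X : Fin n → Ω → S) (ε : Fin n → Ω → ℝ)
        (𝒢 : Set (S → ℝ)) (G : S → ℝ) (C ν β : ℝ),
        EmpiricalProcess.IsSymmetrizedSample P μ X ε →
        EmpiricalProcess.IsUniformEntropyClass μ 𝒢 G C ν β →
        (∀ σ : ℝ, 0 < σ → σ ≤ β →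
          EmpiricalProcess.sigmaZero μ 𝒢 ^ 2 ≤ σ ^ 2 →
          (∀ g ∈ 𝒢, ∀ x, |g x| ≤
            1 / (4 * √ν) * √(n * σ ^ 2 / Real.log (EmpiricalProcess.C₁ C ν * β / σ))) →
          EmpiricalProcess.rademacherMoment P 𝒢 X ε ≤
            ENNReal.ofReal
              (A * √(ν * n * σ ^ 2 * Real.log (EmpiricalProcess.C₁ C ν * β / σ)))) ∧
        (∀ U : ℝ, (∀ g ∈ 𝒢, ∀ x, |g x| ≤ U) →
          EmpiricalProcess.sigmaZero μ 𝒢 ≤ U →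
          U ≤ EmpiricalProcess.C₂ C ν * √n * β →
          EmpiricalProcess.rademacherMoment P 𝒢 X ε ≤
            ENNReal.ofReal
              (A * (√(ν * n * EmpiricalProcess.sigmaZero μ 𝒢 ^ 2 *
                    Real.log (EmpiricalProcess.C₁ C ν * β / EmpiricalProcess.sigmaZero μ 𝒢))
                + 2 * ν * U * Real.log (EmpiricalProcess.C₃ C ν * n * (β / U) ^ 2)))) := by
  refine ⟨18432, by norm_num, ?_⟩
  intro Ω _ P _ S _ μ _ n X ε 𝒢 G C ν β hX hE
  exact ⟨fun σ hσ hσβ hσ₀ hg => hE.rademacherMoment_le_of_le_sqrt hX hσ hσβ hσ₀ hg,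
    fun U hg hσU hUβ => hE.rademacherMoment_le_of_abs_le hX hg hσU hUβ⟩
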